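/- Let $(B,\mathcal H,\mu)$ be an abstract Wiener space: $\mu$ is a centred Gaussian measure on a separable real Banach space $B$ with Cameron--Martin space $\mathcal H\subset B$. Let $(e_i)$ be an orthonormal basis of $\mathcal H$ consisting of elements of $B^\star$, where $B^\star$ is mapped to $\mathcal H$ by dualising the inclusion $\mathcal H\subset B$ and identifying $\mathcal H^\star$ with $\mathcal H$. Let $H_k$ be the Hermite polynomials normalised by $\exp(\lambda x-\tfrac12\lambda^2)=\sum_{k\ge0}\frac{\lambda^k}{\sqrt{k!}}H_k(x)$ and, for a finitely supported multi-index $\alpha$ with $|\alpha|=\sum_i\alpha_i$, let $H_\alpha(\xi)=\prod_iH_{\alpha_i}(\langle\xi,e_i\rangle)$. For a separable real Banach space $E$ and $k\ge 0$, the $k$-th $E$-valued Wiener chaos $\mathcal H^{(k)}(\mu,E)$ is the closure in $L^2(\mu,E)$ of the linear span of the random variables $H_\alpha(\xi)\,y$ with $|\alpha|=k$ and $y\in E$. Let $\mathcal W$ be a finite set and, for each $\tau\in\mathcal W$, let $E_\tau$ be a separable real Banach space and $K_\tau\in\{0,1,2,\dots\}$; put $\mathbf E=\bigoplus_{\tau\in\mathcal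 W}E_\tau$. For each $\delta\in[0,1)$ let $\mathbf\Psi_\delta=\bigoplus_\tau\Psi_{\delta;\tau}$ with $\Psi_{\delta;\tau}=\sum_{k=0}^{K_\tau}\Psi_{\delta;\tau,k}$ and $\Psi_{\delta;\tau,k}\in\mathcal H^{(k)}(\mu,E_\tau)$, write $\mathbf\Psi=\mathbf\Psi_0$ (and $\Psi_{\tau,k}=\Psi_{0;\tau,k}$), and assume that for all $\tau\in\mathcal W$ and $k\le K_\tau$ $$\lim_{\delta\downarrow0}\int\|\Psi_{\delta;\tau,k}(\xi)-\Psi_{\tau,k}(\xi)\|_{E_\tau}^2\,\mu(d\xi)=0 .$$ For $h\in\mathcal H$ let $\mathbf\Psi_{\mathrm{hom}}(h)=\bigoplus_\tau\int\Psi_{\tau,K_\tau}(\xi+h)\,\mu(d\xi)$, and for $\varepsilon>0$ let $\mathbf\Psi_\delta^{(\varepsilon)}=\bigoplus_\tau\varepsilon^{K_\tau/2}\,\Psi_{\delta;\tau}$. Then for every function $\varepsilon\mapsto\delta(\varepsilon)\ge0$ with $\lim_{\varepsilon\downarrow0}\delta(\varepsilon)=0$ the random variables $\mathbf\Psi^{(\varepsilon)}_{\delta(\varepsilon)}$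 satisfy, under $\mu$, a large deviation principle on $\mathbf E$ with rate $\varepsilon$ and rate function $$\mathscr I(\mathbf s)=\inf\Big\{\tfrac12|h|_{\mathcal H}^2\ :\ h\in\mathcal H,\ \mathbf\Psi_{\mathrm{hom}}(h)=\mathbf s\Big\}\qquad(\inf\emptyset=+\infty).$$ That is, $\mathscr I:\mathbf E\to[0,+\infty]$ is lower semicontinuous, has compact sublevel sets $\{\mathscr I\le c\}$, $c<\infty$, and is not identically $+\infty$; for every closed $\mathcal C\subseteq\mathbf E$, $\limsup_{\varepsilon\downarrow0}\varepsilon\log\mu(\mathbf\Psi^{(\varepsilon)}_{\delta(\varepsilon)}\in\mathcal C)\le-\inf_{\mathcal C}\mathscr I$; and for every open $\mathcal O\subseteq\mathbf E$, $\liminf_{\varepsilon\downarrow0}\varepsilon\log\mu(\mathbf\Psi^{(\varepsilon)}_{\delta(\varepsilon)}\in\mathcal O)\ge-\inf_{\mathcal O}\mathscr I$. -/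

import Mathlib

open MeasureTheory ProbabilityTheory Filter Topology
open scoped ENNReal NNReal

noncomputable section

/-- A family `ν ε`, `ε > 0`, of probability measures satisfies a large deviation principle with
rate `ε` and (good) rate function `I`. Logarithms and infima take values in the extended reals,
so that `log 0 = -∞` and the infimum over the empty set is `+∞`. -/
structure SatisfiesLDP {S : Type*} [TopologicalSpace S] [MeasurableSpace S]
    (ν : ℝ → Measure S) (I : S → ℝ≥0∞) : Prop where
  isProbabilityMeasure : ∀ ε : ℝ, 0 < ε → IsProbabilityMeasure (ν ε)
  lowerSemicontinuous : LowerSemicontinuous I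
  isCompact_sublevel : ∀ c : ℝ≥0, IsCompact {s : S | I s ≤ c}
  exists_ne_top : ∃ s : S, I s ≠ ⊤
  upper_bound : ∀ C : Set S, IsClosed C →
    limsup (fun ε : ℝ => (ε : EReal) * ENNReal.log (ν ε C)) (𝓝[>] 0)
      ≤ -((⨅ s ∈ C, I s : ℝ≥0∞) : EReal)
  lower_bound : ∀ O : Set S, IsOpen O →
    -((⨅ s ∈ O, I s : ℝ≥0∞) : EReal)
      ≤ liminf (fun ε : ℝ => (ε : EReal) * ENNReal.log (ν ε O)) (𝓝[>] 0)

namespace WienerChaos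

section WienerSpace

variable {B H : Type*} [NormedAddCommGroup B] [NormedSpace ℝ B]
  [NormedAddCommGroup H] [InnerProductSpace ℝ H] [CompleteSpace H]

/-- The map `B⋆ → H` obtained by dualising the inclusion `j : H → B` and identifying `H⋆`
with `H`. -/
def dualToH (j : H →L[ℝ] B) (ℓ : StrongDual ℝ B) : H :=
  (InnerProductSpace.toDual ℝ H).symm (ℓ ∘L j)

/-- `(B, H, μ)` is an abstract Wiener space with inclusion `j : H ↪ B`: `μ` is a centred Gaussian
measure on `B`, and the Hilbert space `H ⊆ B` is its Cameron-Martin space, i.e. the covariance of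
`μ` is `(ℓ, ℓ') ↦ ⟪j⋆ ℓ, j⋆ ℓ'⟫_H`. -/
structure IsAbstractWienerSpace [MeasurableSpace B] (j : H →L[ℝ] B) (μ : Measure B) : Prop where
  isGaussian : IsGaussian μ
  centred : ∀ ℓ : StrongDual ℝ B, ∫ ξ, ℓ ξ ∂μ = 0
  injective : Function.Injective j
  covariance : ∀ ℓ ℓ' : StrongDual ℝ B,
    ∫ ξ, ℓ ξ * ℓ' ξ ∂μ = inner ℝ (dualToH j ℓ) (dualToH j ℓ')

end WienerSpace

/-- The Hermite polynomials, normalised to be orthonormal for the standard normal law: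
`exp (λ x - λ² / 2) = ∑ λ ^ k / √k! * H_k x`. -/
def hermiteFun (k : ℕ) (x : ℝ) : ℝ :=
  Polynomial.aeval x (Polynomial.hermite k) / √(k.factorial : ℝ)

section Chaos

variable {B : Type*} [NormedAddCommGroup B] [NormedSpace ℝ B] {ι : Type*}

/-- `H_α (ξ) = ∏ i, H_{α i} (⟨ξ, e i⟩)` for a multi-index `α`. -/
def hermiteMulti (e : ι → StrongDual ℝ B) (α : ι →₀ ℕ) (ξ : B) : ℝ :=
  α.prod fun i n => hermiteFun n (e i ξ)

/-- The `k`-th homogeneous `F`-valued Wiener chaos: the closure in `L²(μ, F)` of the linear span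
of the random variables `H_α(ξ) y` with `|α| = k` and `y ∈ F`. -/
def chaos [MeasurableSpace B] (μ : Measure B) (e : ι → StrongDual ℝ B) (F : Type*)
    [NormedAddCommGroup F] [NormedSpace ℝ F] (k : ℕ) : Submodule ℝ (Lp F 2 μ) :=
  (Submodule.span ℝ {f : Lp F 2 μ | ∃ (α : ι →₀ ℕ) (y : F),
    α.degree = k ∧ f =ᵐ[μ] fun ξ => hermiteMulti e α ξ • y}).topologicalClosure

end Chaos

section Families

variable {B : Type*} [NormedAddCommGroup B] [MeasurableSpace B] {μ : Measure B}
  {W : Type*} {E : W → Type*} [∀ τ, NormedAddCommGroup (E τ)] [∀ τ, NormedSpace ℝ (E τ)]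

/-- The rescaled random variable `⨁ τ, ε ^ (K τ / 2) Ψ_τ`, where `Ψ_τ = ∑ k ≤ K τ, Ψ_{τ, k}`. -/
def rescaled (K : W → ℕ) (Ψ : ∀ τ, ℕ → Lp (E τ) 2 μ) (ε : ℝ) (ξ : B) : ∀ τ, E τ :=
  fun τ => ε ^ ((K τ : ℝ) / 2) • ∑ k ∈ Finset.range (K τ + 1), Ψ τ k ξ

variable [NormedSpace ℝ B] {H : Type*} [NormedAddCommGroup H] [InnerProductSpace ℝ H]

/-- The homogeneous part `h ↦ ⨁ τ, ∫ Ψ_{τ, K τ}(ξ + h) μ(dξ)`. -/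
def homPart (j : H →L[ℝ] B) (K : W → ℕ) (Ψ : ∀ τ, ℕ → Lp (E τ) 2 μ) (h : H) : ∀ τ, E τ :=
  fun τ => ∫ ξ, Ψ τ (K τ) (ξ + j h) ∂μ

/-- `I(s) = inf {|h|² / 2 : h ∈ H, Ψ_hom(h) = s}`, with `inf ∅ = +∞`. -/
def rateFunction (j : H →L[ℝ] B) (K : W → ℕ) (Ψ : ∀ τ, ℕ → Lp (E τ) 2 μ) (s : ∀ τ, E τ) :
    ℝ≥0∞ :=
  ⨅ (h : H) (_ : homPart j K Ψ h = s), ENNReal.ofReal (‖h‖ ^ 2 / 2)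

end Families

end WienerChaos

end

set_option linter.unusedSectionVars false

noncomputable section

namespace WienerChaos

section Concentration

theorem volume_preimage_midpoint (c : ℝ) (D : Set ℝ) :
    volume ((fun x : ℝ => (x + c) / 2) ⁻¹' D) = 2 * volume D := by
  have h : (fun x : ℝ => (x + c) / 2) ⁻¹' D
      = (fun x => x + c) ⁻¹' ((fun x => (2⁻¹ : ℝ) * x) ⁻¹' D) := by
    ext x; simp [div_eq_inv_mul]
  rw [h, measure_preimage_add_right, Real.volume_preimage_mul_left (by norm_num)]
  norm_num

theorem volume_add_le_of_isCompact {A B D : Set ℝ} (hA : IsCompact A) (hB : IsCompact B)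
    (hA' : A.Nonempty) (hB' : B.Nonempty) (h : ∀ a ∈ A, ∀ b ∈ B, (a + b) / 2 ∈ D) :
    volume A + volume B ≤ 2 * volume D := by
  set a₀ := sSup A
  set b₀ := sInf B
  have ha₀ : a₀ ∈ A := hA.sSup_mem hA'
  have hb₀ : b₀ ∈ B := hB.sInf_mem hB'
  have ha : ∀ a ∈ A, a ≤ a₀ := fun a ha => le_csSup hA.bddAbove ha
  have hb : ∀ b ∈ B, b₀ ≤ b := fun b hb => csInf_le hB.bddBelow hb
  set m := (a₀ + b₀) / 2
  have h1 : volume A ≤ 2 * volume (D ∩ Set.Iic m) := by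
    rw [← volume_preimage_midpoint b₀]
    refine measure_mono fun a haA => ⟨h a haA b₀ hb₀, ?_⟩
    have := ha a haA
    simp only [Set.mem_Iic, m]; linarith
  have h2 : volume B ≤ 2 * volume (D \ Set.Iic m) := by
    rw [← volume_preimage_midpoint a₀, ← measure_sdiff_null (s := B) (t := {b₀}) (by simp)]
    refine measure_mono fun b hbB => ⟨?_, ?_⟩
    · have := h a₀ ha₀ b hbB.1
      simpa [add_comm] using this
    · have h3 := hb b hbB.1
      have h4 : b₀ < b := lt_of_le_of_ne h3 fun h => hbB.2 (by simp [h])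
      simp only [Set.mem_Iic, m, not_le]; linarith
  calc volume A + volume B ≤ 2 * volume (D ∩ Set.Iic m) + 2 * volume (D \ Set.Iic m) :=
        add_le_add h1 h2
    _ = 2 * volume D := by rw [← mul_add, measure_inter_add_sdiff _ measurableSet_Iic]

/-- The one-dimensional Brunn-Minkowski inequality. -/
theorem volume_add_le {A B D : Set ℝ} (hA : MeasurableSet A) (hB : MeasurableSet B)
    (hA' : A.Nonempty) (hB' : B.Nonempty) (h : ∀ a ∈ A, ∀ b ∈ B, (a + b) / 2 ∈ D) :
    volume A + volume B ≤ 2 * volume D := by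
  obtain ⟨a, ha⟩ := hA'
  obtain ⟨b, hb⟩ := hB'
  have : Nonempty {K : Set ℝ // K ⊆ A ∧ IsCompact K} := ⟨∅, by simp⟩
  have : Nonempty {K : Set ℝ // K ⊆ B ∧ IsCompact K} := ⟨∅, by simp⟩
  rw [hA.measure_eq_iSup_isCompact, hB.measure_eq_iSup_isCompact]
  simp_rw [iSup_and', iSup_subtype']
  refine ENNReal.iSup_add_iSup_le fun ⟨K, hKA, hK⟩ ⟨L, hLB, hL⟩ => ?_
  have hK' : insert a K ⊆ A := Set.insert_subset ha hKA
  have hL' : insert b L ⊆ B := Set.insert_subset hb hLB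
  calc volume K + volume L ≤ volume (insert a K) + volume (insert b L) :=
        add_le_add (measure_mono (Set.subset_insert _ _)) (measure_mono (Set.subset_insert _ _))
    _ ≤ _ := volume_add_le_of_isCompact (hK.insert a) (hL.insert b) (Set.insert_nonempty _ _)
        (Set.insert_nonempty _ _) fun x hx y hy => h x (hK' hx) y (hL' hy)

/-- Prékopa-Leindler on the line, for functions whose suprema are one. -/
theorem prekopa_leindler_of_iSup_eq_one {u v : ℝ → ℝ≥0∞} {w : ℝ → ℝ≥0} (hu : Measurable u)
    (hv : Measurable v) (hw : Measurable w) (hu1 : ⨆ x, u x = 1) (hv1 : ⨆ x, v x = 1)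
    (h : ∀ x y, u x * v y ≤ (w ((x + y) / 2) : ℝ≥0∞) ^ 2) :
    (∫⁻ x, u x) * (∫⁻ x, v x) ≤ (∫⁻ x, w x) ^ 2 := by
  have layer : ∀ f : ℝ → ℝ≥0∞, Measurable f → (∀ x, f x ≤ 1) →
      ∫⁻ x, f x = ∫⁻ t in Set.Ioo (0 : ℝ) 1, volume {x | ENNReal.ofReal t < f x} := by
    intro f hf hf1
    have hfin : ∀ x, f x ≠ ⊤ := fun x => ne_top_of_le_ne_top ENNReal.one_ne_top (hf1 x)
    have h1 : ∫⁻ x, f x = ∫⁻ x, ENNReal.ofReal (f x).toReal := by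
      refine lintegral_congr fun x => (ENNReal.ofReal_toReal (hfin x)).symm
    rw [h1, lintegral_eq_lintegral_meas_lt _ (ae_of_all _ fun x => ENNReal.toReal_nonneg)
      hf.ennreal_toReal.aemeasurable]
    have h2 : Set.Ioi (0 : ℝ) = Set.Ioo 0 1 ∪ Set.Ici 1 := by
      ext x; simp only [Set.mem_Ioi, Set.mem_union, Set.mem_Ioo, Set.mem_Ici]
      constructor
      · intro hx; rcases lt_or_ge x 1 with h | h <;> simp [h, hx]
      · rintro (h | h) <;> linarith [h]
    rw [h2, lintegral_union measurableSet_Ici (by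
      rw [Set.disjoint_left]; intro x hx hx'; exact absurd hx.2 (not_lt.2 hx'))]
    have h3 : ∫⁻ t in Set.Ici (1 : ℝ), volume {a | t < (f a).toReal} = 0 := by
      rw [setLIntegral_congr_fun (g := fun _ => 0) measurableSet_Ici]
      · simp
      · intro t ht
        have : {a | t < (f a).toReal} = ∅ := by
          ext a
          simp only [Set.mem_ofPred_eq, Set.mem_empty_iff_false, iff_false, not_lt]
          refine le_trans ?_ ht
          simpa using ENNReal.toReal_mono ENNReal.one_ne_top (hf1 a)
        simp [this]
    rw [h3, add_zero]
    refine setLIntegral_congr_fun measurableSet_Ioo fun t ht => ?_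
    congr 1; ext a
    simp only [Set.mem_ofPred_eq]
    rw [ENNReal.ofReal_lt_iff_lt_toReal ht.1.le (hfin a)]
  have hw1 : ∫⁻ t in Set.Ioo (0 : ℝ) 1, volume {x | ENNReal.ofReal t < w x} ≤ ∫⁻ x, w x := by
    have h1 : ∫⁻ x, (w x : ℝ≥0∞) = ∫⁻ x, ENNReal.ofReal (w x : ℝ) := by simp
    rw [h1, lintegral_eq_lintegral_meas_lt _ (ae_of_all _ fun x => NNReal.coe_nonneg _)
      hw.coe_nnreal_real.aemeasurable]
    refine le_trans (le_of_eq (setLIntegral_congr_fun measurableSet_Ioo fun t ht => ?_))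
      (lintegral_mono_set Set.Ioo_subset_Ioi_self)
    congr 1; ext a
    simp only [Set.mem_ofPred_eq]
    rw [ENNReal.ofReal_lt_iff_lt_toReal ht.1.le ENNReal.coe_ne_top]
    simp
  have hne : ∀ f : ℝ → ℝ≥0∞, ⨆ x, f x = 1 → ∀ t < 1, {x | t < f x}.Nonempty := by
    intro f hf t ht
    obtain ⟨x, hx⟩ := lt_iSup_iff.1 (hf ▸ ht)
    exact ⟨x, hx⟩
  have key : (∫⁻ x, u x) + ∫⁻ x, v x ≤ 2 * ∫⁻ x, w x := by
    rw [layer u hu fun x => hu1 ▸ le_iSup u x, layer v hv fun x => hv1 ▸ le_iSup v x]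
    rw [← lintegral_add_left' ?_]
    · refine le_trans ?_ (mul_le_mul_right hw1 2)
      rw [← lintegral_const_mul' _ _ (by simp)]
      refine setLIntegral_mono' measurableSet_Ioo fun t ht => ?_
      have ht1 : ENNReal.ofReal t < 1 := by simpa using ht.2
      refine volume_add_le (measurableSet_lt measurable_const hu)
        (measurableSet_lt measurable_const hv) (hne u hu1 _ ht1)
        (hne v hv1 _ ht1) fun a ha b hb => ?_
      have h1 : ENNReal.ofReal t ^ 2 < (w ((a + b) / 2) : ℝ≥0∞) ^ 2 := by
        refine lt_of_lt_of_le ?_ (h a b)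
        rw [sq]
        exact ENNReal.mul_lt_mul ha hb
      by_contra hcon
      exact absurd h1 (not_lt.2 (pow_le_pow_left₀ zero_le (not_lt.1 hcon) 2))
    · have hanti : Antitone fun t : ℝ => volume {x | ENNReal.ofReal t < u x} :=
        fun s t hst => measure_mono fun x hx => by
          exact lt_of_le_of_lt (ENNReal.ofReal_le_ofReal hst) hx
      exact hanti.measurable.aemeasurable
  have amgm : ∀ a b c : ℝ≥0∞, a + b ≤ 2 * c → a * b ≤ c ^ 2 := by
    intro a b c habc
    rcases eq_or_ne c ⊤ with rfl | hc
    · simp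
    have hab : a + b ≠ ⊤ := ne_top_of_le_ne_top (ENNReal.mul_ne_top (by simp) hc) habc
    lift c to ℝ≥0 using hc
    lift a to ℝ≥0 using (ENNReal.add_ne_top.1 hab).1
    lift b to ℝ≥0 using (ENNReal.add_ne_top.1 hab).2
    norm_cast at habc ⊢
    rw [← NNReal.coe_le_coe] at habc ⊢
    push_cast at habc ⊢
    nlinarith [sq_nonneg ((a : ℝ) - b), a.coe_nonneg, b.coe_nonneg, c.coe_nonneg]
  exact amgm _ _ _ key

/-- The Prékopa-Leindler inequality on the line, with midpoints. -/
theorem prekopa_leindler {u v : ℝ → ℝ≥0∞} {w : ℝ → ℝ≥0} {M : ℝ≥0} (hu : Measurable u)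
    (hv : Measurable v) (hw : Measurable w) (hM : ∀ x, w x ≤ M)
    (h : ∀ x y, u x * v y ≤ (w ((x + y) / 2) : ℝ≥0∞) ^ 2) :
    (∫⁻ x, u x) * (∫⁻ x, v x) ≤ (∫⁻ x, w x) ^ 2 := by
  set p := ⨆ x, u x
  set q := ⨆ x, v x
  have hup : ∀ x, u x ≤ p := le_iSup u
  have hvq : ∀ x, v x ≤ q := le_iSup v
  rcases eq_or_ne p 0 with hp | hp
  · have : ∀ x, u x = 0 := fun x => le_antisymm (hp ▸ hup x) zero_le
    simp [this]
  rcases eq_or_ne q 0 with hq | hq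
  · have : ∀ x, v x = 0 := fun x => le_antisymm (hq ▸ hvq x) zero_le
    simp [this]
  have hpq : p * q ≤ (M : ℝ≥0∞) ^ 2 := by
    rw [ENNReal.iSup_mul]
    refine iSup_le fun x => ?_
    rw [ENNReal.mul_iSup]
    refine iSup_le fun y => (h x y).trans ?_
    gcongr
    exact_mod_cast hM _
  have hpq' : p * q ≠ ⊤ := ne_top_of_le_ne_top (by simp) hpq
  have hp' : p ≠ ⊤ := fun h => hpq' (by rw [h, ENNReal.top_mul hq])
  have hq' : q ≠ ⊤ := fun h => hpq' (by rw [h, ENNReal.mul_top hp])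
  obtain ⟨c, hc⟩ : ∃ c : ℝ≥0, (c : ℝ≥0∞) ^ 2 = p * q := by
    refine ⟨NNReal.sqrt (p * q).toNNReal, ?_⟩
    rw [← ENNReal.coe_pow, NNReal.sq_sqrt, ENNReal.coe_toNNReal hpq']
  have hc0 : c ≠ 0 := by rintro rfl; simp at hc; tauto
  have key := prekopa_leindler_of_iSup_eq_one (u := fun x => p⁻¹ * u x) (v := fun x => q⁻¹ * v x)
    (w := fun x => c⁻¹ * w x) (hu.const_mul _) (hv.const_mul _) (hw.const_mul _)
    (by rw [← ENNReal.mul_iSup]; exact ENNReal.inv_mul_cancel hp hp')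
    (by rw [← ENNReal.mul_iSup]; exact ENNReal.inv_mul_cancel hq hq')
    (fun x y => by
      rw [ENNReal.coe_mul, mul_pow, ENNReal.coe_inv hc0, ← ENNReal.inv_pow, hc,
        ENNReal.mul_inv (.inl hp) (.inl hp'), mul_mul_mul_comm]
      gcongr
      exact h x y)
  simp only [ENNReal.coe_mul] at key
  rw [lintegral_const_mul _ hu, lintegral_const_mul _ hv,
    lintegral_const_mul _ hw.coe_nnreal_ennreal, mul_pow, ENNReal.coe_inv hc0, ← ENNReal.inv_pow,
    hc, mul_mul_mul_comm, ← ENNReal.mul_inv (.inl hp) (.inl hp')] at key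
  exact (ENNReal.mul_le_mul_iff_right (ENNReal.inv_ne_zero.2 hpq')
    (ENNReal.inv_ne_top.2 (mul_ne_zero hp hq))).1 key

/-- The standard normal law. -/
abbrev stdNormal : Measure ℝ := gaussianReal 0 1

theorem lintegral_stdNormal_mul_le {u v : ℝ → ℝ≥0∞} (hu : Measurable u) (hv : Measurable v)
    (h : ∀ x y, u x * v y ≤ ENNReal.ofReal (Real.exp ((x - y) ^ 2 / 4))) :
    (∫⁻ x, u x ∂stdNormal) * (∫⁻ x, v x ∂stdNormal) ≤ 1 := by
  have hpdf : Measurable (gaussianPDF 0 1) := measurable_gaussianPDF 0 1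
  have hle : ∀ x, gaussianPDFReal 0 1 x ≤ (√(2 * Real.pi))⁻¹ := by
    intro x
    rw [gaussianPDFReal_def]
    simp only [NNReal.coe_one, mul_one, sub_zero]
    refine mul_le_of_le_one_right (by positivity) (Real.exp_le_one_iff.2 ?_)
    have := sq_nonneg x
    linarith
  have key := prekopa_leindler (u := fun x => gaussianPDF 0 1 x * u x)
    (v := fun x => gaussianPDF 0 1 x * v x) (w := fun x => (gaussianPDFReal 0 1 x).toNNReal)
    (M := (√(2 * Real.pi))⁻¹.toNNReal) (hpdf.mul hu) (hpdf.mul hv)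
    (measurable_gaussianPDFReal 0 1).real_toNNReal
    (fun x => Real.toNNReal_le_toNNReal (hle x)) (fun x y => by
      calc gaussianPDF 0 1 x * u x * (gaussianPDF 0 1 y * v y)
          = gaussianPDF 0 1 x * gaussianPDF 0 1 y * (u x * v y) := by ring
        _ ≤ gaussianPDF 0 1 x * gaussianPDF 0 1 y *
            ENNReal.ofReal (Real.exp ((x - y) ^ 2 / 4)) := by gcongr; exact h x y
        _ = ENNReal.ofReal (gaussianPDFReal 0 1 ((x + y) / 2)) ^ 2 := by
            rw [gaussianPDF, gaussianPDF, ← ENNReal.ofReal_mul (gaussianPDFReal_nonneg _ _ _),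
              ← ENNReal.ofReal_mul (mul_nonneg (gaussianPDFReal_nonneg _ _ _)
                (gaussianPDFReal_nonneg _ _ _)), ← ENNReal.ofReal_pow (gaussianPDFReal_nonneg _ _ _)]
            congr 1
            simp only [gaussianPDFReal_def, NNReal.coe_one, mul_one, sub_zero]
            rw [mul_pow, mul_mul_mul_comm, mul_assoc, ← Real.exp_add, ← Real.exp_add,
              ← Real.exp_nat_mul, sq (√(2 * Real.pi))⁻¹]
            congr 2
            push_cast
            ring
        _ = _ := rfl)
  have h1 : ∫⁻ x, ((gaussianPDFReal 0 1 x).toNNReal : ℝ≥0∞) = 1 :=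
    lintegral_gaussianPDF_eq_one 0 one_ne_zero
  rw [h1, one_pow] at key
  rw [stdNormal, gaussianReal_of_var_ne_zero 0 one_ne_zero,
    lintegral_withDensity_eq_lintegral_mul _ hpdf hu,
    lintegral_withDensity_eq_lintegral_mul _ hpdf hv]
  exact key

/-- The standard Gaussian measure on `κ → ℝ`. -/
abbrev stdGaussianPi (κ : Type*) [Fintype κ] : Measure (κ → ℝ) := Measure.pi fun _ => stdNormal

theorem lintegral_stdGaussianPi_fin_mul_le (n : ℕ) {u v : (Fin n → ℝ) → ℝ≥0∞}
    (hu : Measurable u) (hv : Measurable v)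
    (h : ∀ x y, u x * v y ≤ ENNReal.ofReal (Real.exp ((∑ i, (x i - y i) ^ 2) / 4))) :
    (∫⁻ x, u x ∂stdGaussianPi (Fin n)) * (∫⁻ x, v x ∂stdGaussianPi (Fin n)) ≤ 1 := by
  induction n with
  | zero =>
    simp only [stdGaussianPi]
    rw [Measure.pi_of_empty (x := 0), lintegral_dirac, lintegral_dirac]
    simpa using h 0 0
  | succ n ih =>
    have split : ∀ f : (Fin (n + 1) → ℝ) → ℝ≥0∞, Measurable f →
        ∫⁻ x, f x ∂stdGaussianPi (Fin (n + 1))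
          = ∫⁻ x, ∫⁻ t, f (Fin.cons t x) ∂stdNormal ∂stdGaussianPi (Fin n) := by
      intro f hf
      have := (measurePreserving_piFinSuccAbove (fun _ : Fin (n + 1) => stdNormal) 0).symm
      rw [← this.lintegral_comp hf, lintegral_prod_symm']
      · simp [MeasurableEquiv.piFinSuccAbove, Fin.insertNthEquiv]
      · exact hf.comp (MeasurableEquiv.measurable _)
    have hcons : Measurable fun p : (Fin n → ℝ) × ℝ => (Fin.cons p.2 p.1 : Fin (n + 1) → ℝ) := by
      rw [measurable_pi_iff]
      intro i
      refine Fin.cases ?_ (fun i => ?_) i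
      · simpa using measurable_snd
      · simpa using (measurable_pi_apply i).fun_comp measurable_fst
    rw [split u hu, split v hv]
    refine ih (hu.comp hcons).lintegral_prod_right' (hv.comp hcons).lintegral_prod_right'
      fun x y => ?_
    set a := (∑ i, (x i - y i) ^ 2) / 4
    have hx : Measurable fun t : ℝ => (Fin.cons t x : Fin (n + 1) → ℝ) :=
      hcons.comp measurable_prodMk_left
    have hy : Measurable fun t : ℝ => (Fin.cons t y : Fin (n + 1) → ℝ) :=
      hcons.comp measurable_prodMk_left
    have key := lintegral_stdNormal_mul_le (u := fun t => u (Fin.cons t x))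
      (v := fun t => ENNReal.ofReal (Real.exp (-a)) * v (Fin.cons t y))
      (hu.comp hx) ((hv.comp hy).const_mul _) (fun s t => by
        rw [mul_left_comm]
        refine (mul_le_mul_right (h _ _) _).trans ?_
        rw [← ENNReal.ofReal_mul (Real.exp_nonneg _), ← Real.exp_add]
        refine ENNReal.ofReal_le_ofReal (Real.exp_le_exp.2 (le_of_eq ?_))
        simp only [Fin.sum_univ_succ, Fin.cons_zero, Fin.cons_succ, a]
        ring)
    rw [lintegral_const_mul _ (hv.fun_comp hy), mul_left_comm] at key
    calc _ = ENNReal.ofReal (Real.exp a) * (ENNReal.ofReal (Real.exp (-a)) *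
          ((∫⁻ t, u (Fin.cons t x) ∂stdNormal) * ∫⁻ t, v (Fin.cons t y) ∂stdNormal)) := by
          rw [← mul_assoc, ← ENNReal.ofReal_mul (Real.exp_nonneg _), ← Real.exp_add]
          simp
      _ ≤ ENNReal.ofReal (Real.exp a) * 1 := by gcongr
      _ = _ := mul_one _

/-- Maurey's property `(τ)` of Gaussian measures. -/
theorem lintegral_stdGaussianPi_mul_le {κ : Type*} [Fintype κ] {u v : (κ → ℝ) → ℝ≥0∞}
    (hu : Measurable u) (hv : Measurable v)
    (h : ∀ x y, u x * v y ≤ ENNReal.ofReal (Real.exp ((∑ i, (x i - y i) ^ 2) / 4))) :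
    (∫⁻ x, u x ∂stdGaussianPi κ) * (∫⁻ x, v x ∂stdGaussianPi κ) ≤ 1 := by
  let f := (Fintype.equivFin κ).symm
  have hf := measurePreserving_piCongrLeft (fun _ : κ => stdNormal) f
  rw [stdGaussianPi, ← hf.lintegral_comp hu, ← hf.lintegral_comp hv]
  refine lintegral_stdGaussianPi_fin_mul_le _ (hu.comp (MeasurableEquiv.measurable _))
    (hv.comp (MeasurableEquiv.measurable _)) fun x y => (h _ _).trans (le_of_eq ?_)
  congr 3
  refine (Fintype.sum_equiv f _ _ fun i => ?_).symm
  simp [MeasurableEquiv.coe_piCongrLeft, Equiv.piCongrLeft_apply]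

/-- Gaussian concentration: sets at Euclidean distance at least `2 √q` satisfy
`γ(A) γ(S) ≤ exp (-q)`. -/
theorem stdGaussianPi_mul_le {κ : Type*} [Fintype κ] {A S : Set (κ → ℝ)} (hA : MeasurableSet A)
    (hS : MeasurableSet S) {q : ℝ} (h : ∀ x ∈ S, ∀ y ∈ A, 4 * q ≤ ∑ i, (x i - y i) ^ 2) :
    stdGaussianPi κ S * stdGaussianPi κ A ≤ ENNReal.ofReal (Real.exp (-q)) := by
  have key := lintegral_stdGaussianPi_mul_le
    (u := S.indicator fun _ => ENNReal.ofReal (Real.exp q)) (v := A.indicator 1)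
    (measurable_const.indicator hS) (measurable_one.indicator hA) (fun x y => by
      by_cases hx : x ∈ S
      · by_cases hy : y ∈ A
        · simp only [hx, hy, Set.indicator_of_mem, Pi.one_apply, mul_one]
          refine ENNReal.ofReal_le_ofReal (Real.exp_le_exp.2 ?_)
          linarith [h x hx y hy]
        · simp [hy]
      · simp [hx])
  rw [lintegral_indicator_const hS, lintegral_indicator_one hA, mul_assoc] at key
  calc _ = ENNReal.ofReal (Real.exp (-q)) * (ENNReal.ofReal (Real.exp q) *
        (stdGaussianPi κ S * stdGaussianPi κ A)) := by
        rw [← mul_assoc, ← ENNReal.ofReal_mul (Real.exp_nonneg _), ← Real.exp_add]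
        simp
    _ ≤ ENNReal.ofReal (Real.exp (-q)) * 1 := by gcongr
    _ = _ := mul_one _

end Concentration

section CameronMartin

variable {B : Type*} [NormedAddCommGroup B] [NormedSpace ℝ B] [CompleteSpace B]
  [SecondCountableTopology B] [MeasurableSpace B] [BorelSpace B] {μ : Measure B} [IsGaussian μ]

theorem variance_dual_of_centred (hμ : ∀ ℓ : StrongDual ℝ B, ∫ ξ, ℓ ξ ∂μ = 0)
    (ℓ : StrongDual ℝ B) : Var[ℓ; μ] = ∫ ξ, ℓ ξ * ℓ ξ ∂μ := by
  rw [variance_eq_integral (by fun_prop), hμ]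
  simp [sq]

theorem covariance_dual_of_centred (hμ : ∀ ℓ : StrongDual ℝ B, ∫ ξ, ℓ ξ ∂μ = 0)
    (ℓ ℓ' : StrongDual ℝ B) : cov[ℓ, ℓ'; μ] = ∫ ξ, ℓ ξ * ℓ' ξ ∂μ := by
  simp [covariance, hμ]

theorem map_dual_eq_gaussianReal (hμ : ∀ ℓ : StrongDual ℝ B, ∫ ξ, ℓ ξ ∂μ = 0)
    (ℓ : StrongDual ℝ B) : μ.map ℓ = gaussianReal 0 (∫ ξ, ℓ ξ * ℓ ξ ∂μ).toNNReal := by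
  rw [IsGaussian.map_eq_gaussianReal, hμ, variance_dual_of_centred hμ]

theorem integrable_dual_mul_dual (ℓ ℓ' : StrongDual ℝ B) :
    Integrable (fun ξ => ℓ ξ * ℓ' ξ) μ :=
  (IsGaussian.memLp_dual μ ℓ 2 (by simp)).integrable_mul (IsGaussian.memLp_dual μ ℓ' 2 (by simp))

theorem integral_dual_mul_self_nonneg (ℓ : StrongDual ℝ B) : 0 ≤ ∫ ξ, ℓ ξ * ℓ ξ ∂μ :=
  integral_nonneg fun _ => mul_self_nonneg _

theorem complexMGF_dual (hμ : ∀ ℓ : StrongDual ℝ B, ∫ ξ, ℓ ξ ∂μ = 0) (ℓ : StrongDual ℝ B)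
    (z : ℂ) : ∫ ξ, Complex.exp (z * ℓ ξ) ∂μ
      = Complex.exp ((∫ ξ, ℓ ξ * ℓ ξ ∂μ : ℝ) * z ^ 2 / 2) := by
  have := complexMGF_gaussianReal (map_dual_eq_gaussianReal hμ ℓ) z
  rw [complexMGF] at this
  rw [this, Real.coe_toNNReal _ (integral_dual_mul_self_nonneg ℓ)]
  simp

/-- The Laplace-Fourier transform of the joint law of two linear functionals. -/
theorem integral_exp_dual_mul_exp_dual (hμ : ∀ ℓ : StrongDual ℝ B, ∫ ξ, ℓ ξ ∂μ = 0)
    (L ℓ : StrongDual ℝ B) :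
    ∫ ξ, Complex.exp (L ξ * Complex.I) * Complex.exp (ℓ ξ) ∂μ
      = Complex.exp (-(∫ ξ, L ξ * L ξ ∂μ : ℝ) / 2 + (∫ ξ, ℓ ξ * ℓ ξ ∂μ : ℝ) / 2
        + (∫ ξ, L ξ * ℓ ξ ∂μ : ℝ) * Complex.I) := by
  set c := ∫ ξ, ℓ ξ * ℓ ξ ∂μ with hc
  rcases eq_or_ne c 0 with hc0 | hc0
  · have hℓ : ∀ᵐ ξ ∂μ, ℓ ξ = 0 := by
      have := (integral_eq_zero_iff_of_nonneg (fun ξ => mul_self_nonneg (ℓ ξ))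
        (integrable_dual_mul_dual ℓ ℓ)).1 (hc ▸ hc0)
      filter_upwards [this] with ξ hξ
      simpa using hξ
    have h1 : ∫ ξ, L ξ * ℓ ξ ∂μ = 0 := by
      rw [integral_congr_ae (g := fun _ => (0 : ℝ)), integral_zero]
      filter_upwards [hℓ] with ξ hξ
      simp [hξ]
    have h2 : ∫ ξ, Complex.exp (L ξ * Complex.I) * Complex.exp (ℓ ξ) ∂μ
        = ∫ ξ, Complex.exp (Complex.I * L ξ) ∂μ := by
      refine integral_congr_ae ?_
      filter_upwards [hℓ] with ξ hξ
      simp [hξ, mul_comm]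
    rw [h2, complexMGF_dual hμ, h1, hc0]
    congr 1
    simp
  set a := (∫ ξ, L ξ * ℓ ξ ∂μ) / c with ha
  have hac : ∫ ξ, L ξ * ℓ ξ ∂μ = a * c := by rw [ha]; field_simp
  set M := L - a • ℓ with hM
  have hMℓ : ∫ ξ, M ξ * ℓ ξ ∂μ = 0 := by
    have : ∀ ξ, M ξ * ℓ ξ = L ξ * ℓ ξ - a * (ℓ ξ * ℓ ξ) := fun ξ => by simp [hM]; ring
    simp_rw [this]
    rw [integral_sub (integrable_dual_mul_dual L ℓ) ((integrable_dual_mul_dual ℓ ℓ).const_mul _),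
      integral_const_mul, hac, hc, sub_self]
  have hMM : ∫ ξ, M ξ * M ξ ∂μ = (∫ ξ, L ξ * L ξ ∂μ) - a ^ 2 * c := by
    have : ∀ ξ, M ξ * M ξ = L ξ * L ξ - a * (L ξ * ℓ ξ) - a * (M ξ * ℓ ξ) :=
      fun ξ => by simp [hM]; ring
    simp_rw [this]
    rw [integral_sub (f := fun ξ => L ξ * L ξ - a * (L ξ * ℓ ξ)) ((integrable_dual_mul_dual L L).sub
      ((integrable_dual_mul_dual L ℓ).const_mul _)) ((integrable_dual_mul_dual M ℓ).const_mul _),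
      integral_sub (integrable_dual_mul_dual L L) ((integrable_dual_mul_dual L ℓ).const_mul _),
      integral_const_mul, integral_const_mul, hMℓ, hac]
    ring
  have hindep : IndepFun M ℓ μ := by
    refine HasGaussianLaw.indepFun_of_covariance_eq_zero ?_ ?_
    · exact (IsGaussian.hasGaussianLaw_id (μ := μ)).map_fun (M.prod ℓ)
    · rw [covariance_dual_of_centred hμ, hMℓ]
  have h1 : ∀ ξ, Complex.exp (L ξ * Complex.I) * Complex.exp (ℓ ξ)
      = Complex.exp (Complex.I * M ξ) * Complex.exp ((1 + a * Complex.I) * ℓ ξ) := by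
    intro ξ
    rw [← Complex.exp_add, ← Complex.exp_add]
    congr 1
    simp [hM]
    ring
  simp_rw [h1]
  rw [hindep.integral_fun_comp_mul_comp (f := fun x : ℝ => Complex.exp (Complex.I * x))
    (g := fun x : ℝ => Complex.exp ((1 + a * Complex.I) * x)) (by fun_prop) (by fun_prop)
    (by fun_prop) (by fun_prop), complexMGF_dual hμ, complexMGF_dual hμ, ← Complex.exp_add, hMM, hac,
    ← hc]
  congr 1
  push_cast
  ring_nf
  simp only [Complex.I_sq]
  ring

/-- The Cameron-Martin formula for a shift in the direction dual to a continuous functional. -/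
theorem map_add_const_eq_withDensity (hμ : ∀ ℓ : StrongDual ℝ B, ∫ ξ, ℓ ξ ∂μ = 0)
    (ℓ : StrongDual ℝ B) (v : B) (hv : ∀ L : StrongDual ℝ B, ∫ ξ, L ξ * ℓ ξ ∂μ = L v) :
    μ.map (fun ξ => ξ + v)
      = μ.withDensity fun ξ => ENNReal.ofReal (Real.exp (ℓ ξ - ℓ v / 2)) := by
  have hmeas : Measurable fun ξ => Real.exp (ℓ ξ - ℓ v / 2) := by fun_prop
  have hint : Integrable (fun ξ => Real.exp (ℓ ξ - ℓ v / 2)) μ := by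
    have : Integrable (fun x : ℝ => Real.exp x) (μ.map ℓ) := by
      rw [map_dual_eq_gaussianReal hμ]
      simpa using integrable_exp_mul_gaussianReal (μ := 0) (v := (∫ ξ, ℓ ξ * ℓ ξ ∂μ).toNNReal) 1
    have h2 := (this.comp_measurable (by fun_prop)).mul_const (Real.exp (-(ℓ v / 2)))
    refine h2.congr (ae_of_all _ fun ξ => ?_)
    simp [sub_eq_add_neg, Real.exp_add]
  have hfin : IsFiniteMeasure
      (μ.withDensity fun ξ => ENNReal.ofReal (Real.exp (ℓ ξ - ℓ v / 2))) := by
    refine isFiniteMeasure_withDensity ?_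
    exact hint.lintegral_lt_top.ne
  refine Measure.ext_of_charFunDual (funext fun L => ?_)
  rw [charFunDual_map_add_const, charFunDual_apply, charFunDual_apply,
    integral_withDensity_eq_integral_toReal_smul hmeas.ennreal_ofReal (by simp)]
  have h1 : ∀ ξ, (ENNReal.ofReal (Real.exp (ℓ ξ - ℓ v / 2))).toReal •
      Complex.exp (L ξ * Complex.I) = Complex.exp (-(ℓ v / 2 : ℝ)) *
        (Complex.exp (L ξ * Complex.I) * Complex.exp (ℓ ξ)) := by
    intro ξ
    rw [ENNReal.toReal_ofReal (Real.exp_nonneg _), Complex.real_smul, Complex.ofReal_exp,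
      ← Complex.exp_add, ← Complex.exp_add, ← Complex.exp_add]
    congr 1
    push_cast; ring
  have h2 : ∀ ξ, Complex.exp (L ξ * Complex.I) = Complex.exp (Complex.I * L ξ) := by
    intro ξ; rw [mul_comm]
  simp_rw [h1]
  rw [integral_const_mul, integral_exp_dual_mul_exp_dual hμ, hv, hv]
  simp_rw [h2]
  rw [complexMGF_dual hμ, ← Complex.exp_add, ← Complex.exp_add]
  congr 1
  push_cast
  simp only [Complex.I_sq]
  ring

/-- The `L²` form of the Cameron-Martin theorem. -/
theorem lintegral_add_const_le (hμ : ∀ ℓ : StrongDual ℝ B, ∫ ξ, ℓ ξ ∂μ = 0)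
    (ℓ : StrongDual ℝ B) (v : B) (hv : ∀ L : StrongDual ℝ B, ∫ ξ, L ξ * ℓ ξ ∂μ = L v)
    {f : B → ℝ≥0∞} (hf : Measurable f) :
    ∫⁻ ξ, f (ξ + v) ∂μ
      ≤ ENNReal.ofReal (Real.exp (ℓ v / 2)) * (∫⁻ ξ, f ξ ^ 2 ∂μ) ^ (1 / 2 : ℝ) := by
  have hD : Measurable fun ξ => ENNReal.ofReal (Real.exp (ℓ ξ - ℓ v / 2)) := by fun_prop
  have h1 : ∫⁻ ξ, f (ξ + v) ∂μ
      = ∫⁻ ξ, ((fun ξ => ENNReal.ofReal (Real.exp (ℓ ξ - ℓ v / 2))) * f) ξ ∂μ := by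
    rw [← lintegral_withDensity_eq_lintegral_mul _ hD hf,
      ← map_add_const_eq_withDensity hμ ℓ v hv, lintegral_map hf (by fun_prop)]
  have h2 : ∫⁻ ξ, ENNReal.ofReal (Real.exp (ℓ ξ - ℓ v / 2)) ^ (2 : ℝ) ∂μ
      = ENNReal.ofReal (Real.exp (ℓ v)) := by
    have h3 : ∀ ξ, ENNReal.ofReal (Real.exp (ℓ ξ - ℓ v / 2)) ^ (2 : ℝ)
        = ENNReal.ofReal (Real.exp (-(ℓ v)) * Real.exp (2 * ℓ ξ)) := by
      intro ξ
      rw [ENNReal.ofReal_rpow_of_pos (Real.exp_pos _), ← Real.exp_mul, ← Real.exp_add]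
      congr 2; ring
    simp_rw [h3]
    have hmgf := mgf_gaussianReal (map_dual_eq_gaussianReal hμ ℓ) 2
    rw [hv, Real.coe_toNNReal _ (by rw [← hv ℓ]; exact integral_dual_mul_self_nonneg ℓ)] at hmgf
    rw [← ofReal_integral_eq_lintegral_ofReal, integral_const_mul]
    · rw [mgf] at hmgf
      rw [hmgf, ← Real.exp_add]
      congr 2; ring
    · refine Integrable.const_mul ?_ _
      have : Integrable (fun x : ℝ => Real.exp (2 * x)) (μ.map ℓ) := by
        rw [map_dual_eq_gaussianReal hμ]
        exact integrable_exp_mul_gaussianReal 2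
      exact this.comp_measurable (by fun_prop)
    · exact ae_of_all _ fun ξ => by positivity
  rw [h1]
  refine (ENNReal.lintegral_mul_le_Lp_mul_Lq μ Real.HolderConjugate.two_two hD.aemeasurable
    hf.aemeasurable).trans (le_of_eq ?_)
  rw [h2, ENNReal.ofReal_rpow_of_pos (Real.exp_pos _), ← Real.exp_mul]
  simp only [ENNReal.rpow_two]
  congr 3
  ring

end CameronMartin

section StdGaussianPi

variable {κ : Type*} [Fintype κ]

theorem iIndepFun_eval_stdGaussianPi :
    iIndepFun (fun (i : κ) (x : κ → ℝ) => x i) (stdGaussianPi κ) :=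
  iIndepFun_pi (X := fun _ => id) fun _ => aemeasurable_id

theorem map_eval_stdGaussianPi (i : κ) :
    (stdGaussianPi κ).map (fun x => x i) = stdNormal :=
  (measurePreserving_eval (fun _ : κ => stdNormal) i).map_eq

instance isGaussian_stdGaussianPi : IsGaussian (stdGaussianPi κ) := by
  have h2 : HasGaussianLaw (fun (x : κ → ℝ) (i : κ) => x i) (stdGaussianPi κ) := by
    refine iIndepFun.hasGaussianLaw (fun i => ⟨?_⟩) iIndepFun_eval_stdGaussianPi
    rw [map_eval_stdGaussianPi]
    infer_instance
  have := h2.isGaussian_map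
  simpa using this

theorem integral_eval_stdGaussianPi (i : κ) : ∫ x, x i ∂stdGaussianPi κ = 0 := by
  have := integral_map (μ := stdGaussianPi κ) (φ := fun x => x i) (f := fun x : ℝ => x)
    (measurable_pi_apply i).aemeasurable (by fun_prop)
  rw [← this, map_eval_stdGaussianPi, integral_id_gaussianReal]

theorem integral_sq_stdNormal : ∫ x, x * x ∂stdNormal = 1 := by
  have := variance_fun_id_gaussianReal (μ := 0) (v := 1)
  rw [variance_eq_integral (by fun_prop), integral_id_gaussianReal] at this
  simpa [sq] using this

theorem integral_eval_mul_eval_stdGaussianPi [DecidableEq κ] (i k : κ) :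
    ∫ x, x i * x k ∂stdGaussianPi κ = if i = k then 1 else 0 := by
  split_ifs with hik
  · subst hik
    have := integral_map (μ := stdGaussianPi κ) (φ := fun x => x i) (f := fun x : ℝ => x * x)
      (measurable_pi_apply i).aemeasurable (by fun_prop)
    rw [← this, map_eval_stdGaussianPi, integral_sq_stdNormal]
  · rw [((iIndepFun_eval_stdGaussianPi (κ := κ)).indepFun hik).integral_fun_mul_eq_mul_integral
      (measurable_pi_apply i).aestronglyMeasurable (measurable_pi_apply k).aestronglyMeasurable,
      integral_eval_stdGaussianPi, zero_mul]

theorem integrable_eval_stdGaussianPi (i : κ) : Integrable (fun x => x i) (stdGaussianPi κ) :=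
  IsGaussian.integrable_dual (stdGaussianPi κ) (ContinuousLinearMap.proj i)

theorem dual_pi_apply [DecidableEq κ] (L : StrongDual ℝ (κ → ℝ)) (x : κ → ℝ) :
    L x = ∑ i, x i * L (Pi.single i 1) := by
  conv_lhs => rw [pi_eq_sum_univ' x]
  simp [map_sum]

theorem integral_dual_stdGaussianPi (L : StrongDual ℝ (κ → ℝ)) :
    ∫ x, L x ∂stdGaussianPi κ = 0 := by
  classical
  rw [integral_congr_ae (ae_of_all _ (dual_pi_apply L)), integral_finsetSum _ fun i _ => (integrable_eval_stdGaussianPi i).mul_const _]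
  simp_rw [integral_mul_const, integral_eval_stdGaussianPi, zero_mul, Finset.sum_const_zero]

/-- The functional `x ↦ ∑ i, h i * x i`. -/
def dotDual (h : κ → ℝ) : StrongDual ℝ (κ → ℝ) :=
  ∑ i, h i • ContinuousLinearMap.proj (R := ℝ) (φ := fun _ : κ => ℝ) i

theorem dotDual_apply (h x : κ → ℝ) : dotDual h x = ∑ i, h i * x i := by
  simp [dotDual]

theorem integral_dual_mul_dotDual (L : StrongDual ℝ (κ → ℝ)) (h : κ → ℝ) :
    ∫ x, L x * dotDual h x ∂stdGaussianPi κ = L h := by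
  classical
  have h0 : ∀ i k : κ, Integrable (fun x : κ → ℝ => x i * x k) (stdGaussianPi κ) := fun i k =>
    integrable_dual_mul_dual (ContinuousLinearMap.proj (R := ℝ) (φ := fun _ : κ => ℝ) i)
      (ContinuousLinearMap.proj (R := ℝ) (φ := fun _ : κ => ℝ) k)
  have h1 : ∀ x : κ → ℝ, L x * dotDual h x
      = ∑ i, ∑ k, L (Pi.single i 1) * h k * (x i * x k) := by
    intro x
    rw [dual_pi_apply L x, dotDual_apply, Finset.sum_mul_sum]
    refine Finset.sum_congr rfl fun i _ => Finset.sum_congr rfl fun k _ => by ring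
  simp_rw [h1]
  rw [integral_finsetSum _ fun i _ => integrable_finsetSum _ fun k _ => (h0 i k).const_mul _]
  simp_rw [integral_finsetSum _ fun k _ => (h0 _ k).const_mul _, integral_const_mul,
    integral_eval_mul_eval_stdGaussianPi]
  rw [dual_pi_apply L h]
  simp [mul_comm]

theorem lintegral_stdGaussianPi_add_le (h : κ → ℝ) {f : (κ → ℝ) → ℝ≥0∞} (hf : Measurable f) :
    ∫⁻ x, f (x + h) ∂stdGaussianPi κ ≤ ENNReal.ofReal (Real.exp ((∑ i, h i ^ 2) / 2)) *
      (∫⁻ x, f x ^ 2 ∂stdGaussianPi κ) ^ (1 / 2 : ℝ) := by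
  have := lintegral_add_const_le integral_dual_stdGaussianPi (dotDual h) h
    (fun L => integral_dual_mul_dotDual L h) hf
  simpa [dotDual_apply, sq] using this

/-- Rotation invariance of the standard Gaussian measure. -/
theorem lintegral_lintegral_mehler {ρ σ : ℝ} (hρσ : ρ ^ 2 + σ ^ 2 = 1) {f : (κ → ℝ) → ℝ≥0∞}
    (hf : Measurable f) :
    ∫⁻ x, ∫⁻ z, f (ρ • x + σ • z) ∂stdGaussianPi κ ∂stdGaussianPi κ
      = ∫⁻ x, f x ∂stdGaussianPi κ := by
  obtain ⟨θ, hθ⟩ : ∃ θ : ℝ, Real.cos θ = ρ ∧ Real.sin θ = σ := by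
    have hnorm : ‖(⟨ρ, σ⟩ : ℂ)‖ = 1 := by
      rw [Complex.norm_def, Complex.normSq_mk, ← sq, ← sq, hρσ, Real.sqrt_one]
    have hne : (⟨ρ, σ⟩ : ℂ) ≠ 0 := by rw [← norm_ne_zero_iff, hnorm]; exact one_ne_zero
    exact ⟨Complex.arg ⟨ρ, σ⟩, by rw [Complex.cos_arg hne, hnorm]; simp,
      by rw [Complex.sin_arg, hnorm]; simp⟩
  have hrot := IsGaussian.map_rotation_eq_self_of_forall_strongDual_eq_zero
    (integral_dual_stdGaussianPi (κ := κ)) θ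
  have h1 : ∫⁻ p, f p.1 ∂(stdGaussianPi κ).prod (stdGaussianPi κ)
      = ∫⁻ x, f x ∂stdGaussianPi κ := by
    rw [lintegral_prod _ (by fun_prop)]
    simp
  rw [← h1, ← hrot, lintegral_map (by fun_prop) (by fun_prop), lintegral_prod _ (by fun_prop)]
  simp only [ContinuousLinearMap.rotation_apply, hθ.1, hθ.2]

end StdGaussianPi

section Hermite

open Polynomial

theorem derivative_hermite_succ (n : ℕ) :
    derivative (hermite (n + 1)) = (n + 1 : ℤ[X]) * hermite n := by
  induction n with
  | zero => simp
  | succ n ih =>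
    rw [hermite_succ (n + 1), derivative_sub, derivative_mul, derivative_X, ih, derivative_mul,
      one_mul, hermite_succ n]
    have : derivative ((n : ℤ[X]) + 1) = 0 := by simp
    rw [this]
    push_cast
    ring

/-- The monic Hermite polynomial as a function. -/
def hermiteMonic (k : ℕ) (x : ℝ) : ℝ := aeval x (hermite k)

theorem hermiteMonic_zero (x : ℝ) : hermiteMonic 0 x = 1 := by simp [hermiteMonic]

theorem hermiteMonic_one (x : ℝ) : hermiteMonic 1 x = x := by simp [hermiteMonic]

theorem hermiteMonic_add_two (k : ℕ) (x : ℝ) :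
    hermiteMonic (k + 2) x = x * hermiteMonic (k + 1) x - (k + 1) * hermiteMonic k x := by
  simp only [hermiteMonic]
  rw [hermite_succ (k + 1), derivative_hermite_succ]
  simp

theorem hermiteFun_eq (k : ℕ) (x : ℝ) :
    hermiteFun k x = hermiteMonic k x / √(k.factorial : ℝ) := rfl

theorem integrable_pow_stdNormal (n : ℕ) : Integrable (fun x : ℝ => x ^ n) stdNormal := by
  have h : MemLp (id : ℝ → ℝ) (n : ℝ≥0∞) stdNormal := by
    simpa using memLp_id_gaussianReal (μ := 0) (v := 1) (n : ℝ≥0)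
  refine h.integrable_norm_pow'.mono (by fun_prop) (ae_of_all _ fun x => ?_)
  simp

theorem integrable_eval_stdNormal (p : ℝ[X]) : Integrable (fun x => p.eval x) stdNormal := by
  simp_rw [eval_eq_sum_range]
  exact integrable_finsetSum _ fun i _ => (integrable_pow_stdNormal i).const_mul _

/-- Gaussian integration by parts for polynomials. -/
theorem integral_mul_eval_stdNormal (p : ℝ[X]) :
    ∫ x, x * p.eval x ∂stdNormal = ∫ x, p.derivative.eval x ∂stdNormal := by
  have hpdf : ∀ x, gaussianPDFReal 0 1 x = (√(2 * Real.pi))⁻¹ * Real.exp (-(x ^ 2 / 2)) := by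
    intro x
    rw [gaussianPDFReal_def]
    simp [neg_div]
  have hderiv : ∀ x, HasDerivAt (gaussianPDFReal 0 1) (-x * gaussianPDFReal 0 1 x) x := by
    intro x
    have h1 : HasDerivAt (fun x : ℝ => (√(2 * Real.pi))⁻¹ * Real.exp (-(x ^ 2 / 2)))
        ((√(2 * Real.pi))⁻¹ * (Real.exp (-(x ^ 2 / 2)) * (-x))) x := by
      refine HasDerivAt.const_mul _ (HasDerivAt.exp ?_)
      have := ((hasDerivAt_pow 2 x).div_const 2).fun_neg
      simpa using this
    rw [show gaussianPDFReal 0 1 = fun x => (√(2 * Real.pi))⁻¹ * Real.exp (-(x ^ 2 / 2)) from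
      funext hpdf]
    convert! h1 using 1
    ring
  have hint : ∀ q : ℝ[X], Integrable (fun x => q.eval x * gaussianPDFReal 0 1 x) volume := by
    intro q
    have := integrable_eval_stdNormal q
    rw [stdNormal, gaussianReal_of_var_ne_zero 0 one_ne_zero,
      integrable_withDensity_iff (measurable_gaussianPDF 0 1) (ae_of_all _ fun x =>
        gaussianPDF_lt_top)] at this
    simpa [toReal_gaussianPDF] using this
  have key := integral_mul_deriv_eq_deriv_mul_of_integrable (u := fun x => p.eval x)
    (v := gaussianPDFReal 0 1) (u' := fun x => p.derivative.eval x)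
    (v' := fun x => -x * gaussianPDFReal 0 1 x) (fun x _ => p.hasDerivAt x) (fun x _ => hderiv x)
    ((hint (-X * p)).congr (ae_of_all _ fun x => by simp; ring)) (hint p.derivative) (hint p)
  rw [integral_gaussianReal_eq_integral_smul one_ne_zero,
    integral_gaussianReal_eq_integral_smul one_ne_zero]
  simp only [smul_eq_mul]
  calc _ = -∫ x, p.eval x * (-x * gaussianPDFReal 0 1 x) := by
        rw [← integral_neg]; congr 1; ext x; ring
    _ = _ := by rw [key, neg_neg]; congr 1; ext x; ring

/-- The Hermite polynomial `He_k (a + σ X)`. -/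
def hermiteAffine (k : ℕ) (a σ : ℝ) : ℝ[X] :=
  ((hermite k).map (algebraMap ℤ ℝ)).comp (C a + C σ * X)

theorem eval_hermiteAffine (k : ℕ) (a σ x : ℝ) :
    (hermiteAffine k a σ).eval x = hermiteMonic k (a + σ * x) := by
  simp [hermiteAffine, hermiteMonic, aeval_def, eval₂_eq_eval_map]

theorem derivative_hermiteAffine (k : ℕ) (a σ : ℝ) :
    (hermiteAffine (k + 1) a σ).derivative = C (σ * (k + 1)) * hermiteAffine k a σ := by
  rw [hermiteAffine, derivative_comp, derivative_map, derivative_hermite_succ, hermiteAffine]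
  simp
  ring

theorem integrable_hermiteMonic_affine (k : ℕ) (a σ : ℝ) :
    Integrable (fun x => hermiteMonic k (a + σ * x)) stdNormal := by
  simpa only [eval_hermiteAffine] using integrable_eval_stdNormal (hermiteAffine k a σ)

theorem integral_hermiteMonic_affine_add_two (k : ℕ) (a σ : ℝ) :
    ∫ x, hermiteMonic (k + 2) (a + σ * x) ∂stdNormal
      = a * ∫ x, hermiteMonic (k + 1) (a + σ * x) ∂stdNormal
        - (1 - σ ^ 2) * (k + 1) * ∫ x, hermiteMonic k (a + σ * x) ∂stdNormal := by
  have hstein : ∫ x, x * hermiteMonic (k + 1) (a + σ * x) ∂stdNormal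
      = σ * (k + 1) * ∫ x, hermiteMonic k (a + σ * x) ∂stdNormal := by
    have := integral_mul_eval_stdNormal (hermiteAffine (k + 1) a σ)
    rw [derivative_hermiteAffine] at this
    simp only [eval_mul, eval_C, eval_hermiteAffine, integral_const_mul] at this
    exact this
  have h1 := integrable_hermiteMonic_affine (k + 1) a σ
  have h0 := integrable_hermiteMonic_affine k a σ
  have hx : Integrable (fun x => x * hermiteMonic (k + 1) (a + σ * x)) stdNormal := by
    refine (integrable_eval_stdNormal (X * hermiteAffine (k + 1) a σ)).congr
      (ae_of_all _ fun x => ?_)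
    simp only [Polynomial.eval_mul, Polynomial.eval_X, eval_hermiteAffine]
  have : ∀ x, hermiteMonic (k + 2) (a + σ * x) = a * hermiteMonic (k + 1) (a + σ * x)
      + σ * (x * hermiteMonic (k + 1) (a + σ * x)) - (k + 1) * hermiteMonic k (a + σ * x) := by
    intro x; rw [hermiteMonic_add_two]; ring
  simp_rw [this]
  rw [integral_sub (f := fun x => a * hermiteMonic (k + 1) (a + σ * x)
      + σ * (x * hermiteMonic (k + 1) (a + σ * x))) ((h1.const_mul _).add (hx.const_mul _))
      (h0.const_mul _), integral_add (h1.const_mul _) (hx.const_mul _), integral_const_mul,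
    integral_const_mul, integral_const_mul, hstein]
  ring

theorem integral_hermiteMonic_affine_one (a σ : ℝ) :
    ∫ x, hermiteMonic 1 (a + σ * x) ∂stdNormal = a := by
  simp_rw [hermiteMonic_one]
  rw [integral_add (integrable_const _) ((integrable_hermiteMonic_affine 1 0 1).congr
    (ae_of_all _ fun x => by simp [hermiteMonic_one]) |>.const_mul σ), integral_const_mul]
  have := integral_id_gaussianReal (μ := 0) (v := 1)
  simp [this]

theorem integral_hermiteMonic_mehler {ρ σ : ℝ} (hρσ : ρ ^ 2 + σ ^ 2 = 1) (k : ℕ) (x : ℝ) :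
    ∫ z, hermiteMonic k (ρ * x + σ * z) ∂stdNormal = ρ ^ k * hermiteMonic k x := by
  induction k using Nat.strong_induction_on with
  | _ k ih =>
    match k with
    | 0 => simp [hermiteMonic_zero]
    | 1 => rw [integral_hermiteMonic_affine_one, hermiteMonic_one, pow_one]
    | k + 2 =>
      rw [integral_hermiteMonic_affine_add_two, ih (k + 1) (by lia), ih k (by lia),
        hermiteMonic_add_two, ← hρσ]
      ring

theorem integral_hermiteMonic_add (k : ℕ) (a : ℝ) :
    ∫ z, hermiteMonic k (a + 1 * z) ∂stdNormal = a ^ k := by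
  induction k using Nat.strong_induction_on with
  | _ k ih =>
    match k with
    | 0 => simp [hermiteMonic_zero]
    | 1 => rw [integral_hermiteMonic_affine_one, pow_one]
    | k + 2 =>
      rw [integral_hermiteMonic_affine_add_two, ih (k + 1) (by lia)]
      ring

/-- The homogenised Hermite polynomials: `t ^ k * He_k x = scaledHermite k t (t * x)`. -/
def scaledHermite : ℕ → ℝ → ℝ → ℝ
  | 0, _, _ => 1
  | 1, _, z => z
  | k + 2, t, z => z * scaledHermite (k + 1) t z - (k + 1) * t ^ 2 * scaledHermite k t z

theorem scaledHermite_mul (k : ℕ) (t x : ℝ) :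
    scaledHermite k t (t * x) = t ^ k * hermiteMonic k x := by
  induction k using Nat.strong_induction_on with
  | _ k ih =>
    match k with
    | 0 => simp [hermiteMonic_zero, scaledHermite]
    | 1 => simp [hermiteMonic_one, scaledHermite]
    | k + 2 =>
      rw [scaledHermite, ih (k + 1) (by lia), ih k (by lia), hermiteMonic_add_two]
      ring

theorem scaledHermite_zero (k : ℕ) (z : ℝ) : scaledHermite k 0 z = z ^ k := by
  induction k using Nat.strong_induction_on with
  | _ k ih =>
    match k with
    | 0 => simp [scaledHermite]
    | 1 => simp [scaledHermite]
    | k + 2 =>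
      rw [scaledHermite, ih (k + 1) (by lia)]
      ring

theorem continuous_scaledHermite (k : ℕ) :
    Continuous fun p : ℝ × ℝ => scaledHermite k p.1 p.2 := by
  induction k using Nat.strong_induction_on with
  | _ k ih =>
    match k with
    | 0 => simpa [scaledHermite] using continuous_const
    | 1 => simpa [scaledHermite] using continuous_snd
    | k + 2 =>
      have h1 := ih (k + 1) (by lia)
      have h0 := ih k (by lia)
      simp only [scaledHermite]
      fun_prop

@[fun_prop]
theorem continuous_hermiteFun (k : ℕ) : Continuous (hermiteFun k) := by
  unfold hermiteFun
  exact (Polynomial.continuous_aeval _).div_const _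

theorem integrable_hermiteFun_affine (k : ℕ) (a σ : ℝ) :
    Integrable (fun x => hermiteFun k (a + σ * x)) stdNormal :=
  (integrable_hermiteMonic_affine k a σ).div_const _

theorem integral_hermiteFun_mehler {ρ σ : ℝ} (hρσ : ρ ^ 2 + σ ^ 2 = 1) (k : ℕ) (x : ℝ) :
    ∫ z, hermiteFun k (ρ * x + σ * z) ∂stdNormal = ρ ^ k * hermiteFun k x := by
  simp_rw [hermiteFun_eq]
  rw [integral_div, integral_hermiteMonic_mehler hρσ, mul_div_assoc]

theorem integral_hermiteFun_add (k : ℕ) (a : ℝ) :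
    ∫ z, hermiteFun k (a + 1 * z) ∂stdNormal = a ^ k / √(k.factorial : ℝ) := by
  simp_rw [hermiteFun_eq]
  rw [integral_div, integral_hermiteMonic_add]

end Hermite

section HermiteProd

variable {κ : Type*} [Fintype κ] {F : Type*} [NormedAddCommGroup F] [NormedSpace ℝ F]

/-- Products of Hermite polynomials in finitely many variables. -/
def hermiteProd (α : κ → ℕ) (z : κ → ℝ) : ℝ := ∏ i, hermiteFun (α i) (z i)

@[fun_prop]
theorem continuous_hermiteProd (α : κ → ℕ) : Continuous (hermiteProd α) := by
  unfold hermiteProd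
  fun_prop

theorem integrable_hermiteProd_affine (α : κ → ℕ) (a : κ → ℝ) (σ : ℝ) :
    Integrable (fun z => hermiteProd α (a + σ • z)) (stdGaussianPi κ) :=
  Integrable.fintype_prod (f := fun i t => hermiteFun (α i) (a i + σ * t))
    fun i => integrable_hermiteFun_affine (α i) (a i) σ

theorem integral_hermiteProd_mehler {ρ σ : ℝ} (hρσ : ρ ^ 2 + σ ^ 2 = 1) (α : κ → ℕ)
    (x : κ → ℝ) :
    ∫ z, hermiteProd α (ρ • x + σ • z) ∂stdGaussianPi κ = ρ ^ (∑ i, α i) * hermiteProd α x := by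
  have := integral_fintype_prod_eq_prod (𝕜 := ℝ) (μ := fun _ : κ => stdNormal)
    (fun i t => hermiteFun (α i) (ρ * x i + σ * t))
  simp only [hermiteProd, Pi.add_apply, Pi.smul_apply, smul_eq_mul]
  rw [stdGaussianPi, this]
  simp_rw [integral_hermiteFun_mehler hρσ]
  rw [Finset.prod_mul_distrib, Finset.prod_pow_eq_pow_sum]

theorem integral_hermiteProd_add (α : κ → ℕ) (a : κ → ℝ) :
    ∫ z, hermiteProd α (z + a) ∂stdGaussianPi κ
      = ∏ i, a i ^ α i / √((α i).factorial : ℝ) := by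
  have := integral_fintype_prod_eq_prod (𝕜 := ℝ) (μ := fun _ : κ => stdNormal)
    (fun i t => hermiteFun (α i) (a i + 1 * t))
  simp_rw [integral_hermiteFun_add] at this
  rw [← this]
  simp [hermiteProd, add_comm]

/-- Linear combinations of products of Hermite polynomials, with vector coefficients. -/
def hermiteComb {A : Type*} (J : Finset A) (α : A → κ → ℕ) (y : A → F) (z : κ → ℝ) : F :=
  ∑ a ∈ J, hermiteProd (α a) z • y a

variable {A : Type*} {J : Finset A} {α : A → κ → ℕ} {y : A → F}

@[fun_prop]
theorem continuous_hermiteComb : Continuous (hermiteComb J α y) := by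
  unfold hermiteComb
  fun_prop

theorem integral_hermiteComb_mehler [CompleteSpace F] {k : ℕ} (hα : ∀ a ∈ J, ∑ i, α a i = k)
    {ρ σ : ℝ} (hρσ : ρ ^ 2 + σ ^ 2 = 1) (x : κ → ℝ) :
    ∫ z, hermiteComb J α y (ρ • x + σ • z) ∂stdGaussianPi κ = ρ ^ k • hermiteComb J α y x := by
  simp only [hermiteComb]
  rw [integral_finsetSum _ fun a _ => (integrable_hermiteProd_affine _ _ _).smul_const _,
    Finset.smul_sum]
  refine Finset.sum_congr rfl fun a ha => ?_
  rw [integral_smul_const, integral_hermiteProd_mehler hρσ, hα a ha, mul_smul]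

/-- Smoothing estimate: the Mehler semigroup turns a homogeneous Hermite combination into a
function with controlled growth under shifts. -/
theorem enorm_hermiteComb_le [CompleteSpace F] {k : ℕ} (hα : ∀ a ∈ J, ∑ i, α a i = k)
    {ρ σ : ℝ} (hσ : 0 < σ) (hρσ : ρ ^ 2 + σ ^ 2 = 1) (x w : κ → ℝ) :
    ‖ρ ^ k • hermiteComb J α y x‖ₑ
      ≤ ENNReal.ofReal (Real.exp ((ρ ^ 2 / σ ^ 2 * ∑ i, (x i - w i) ^ 2) / 2)) *
        (∫⁻ z, ‖hermiteComb J α y (ρ • w + σ • z)‖ₑ ^ 2 ∂stdGaussianPi κ) ^ (1 / 2 : ℝ) := by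
  have hm : Measurable fun z => ‖hermiteComb J α y (ρ • w + σ • z)‖ₑ := by
    have := continuous_hermiteComb (J := J) (α := α) (y := y)
    exact Continuous.measurable (by fun_prop)
  have key := lintegral_stdGaussianPi_add_le ((ρ / σ) • (x - w)) hm
  rw [← integral_hermiteComb_mehler hα hρσ]
  refine (enorm_integral_le_lintegral_enorm _).trans ?_
  have h1 : ∀ z : κ → ℝ, ρ • w + σ • (z + (ρ / σ) • (x - w)) = ρ • x + σ • z := by
    intro z; ext i
    simp only [Pi.add_apply, Pi.smul_apply, smul_eq_mul, Pi.sub_apply]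
    field_simp
    ring
  simp_rw [h1] at key
  refine key.trans (le_of_eq ?_)
  congr 4
  rw [Finset.mul_sum]
  refine Finset.sum_congr rfl fun i _ => ?_
  simp only [Pi.smul_apply, smul_eq_mul, Pi.sub_apply]
  ring

theorem stdGaussianPi_hermiteComb_tail [CompleteSpace F] {k : ℕ}
    (hα : ∀ a ∈ J, ∑ i, α a i = k) {r N : ℝ} (hr : 1 < r) (hN : 0 < N)
    (hΦ : ∫⁻ z, ‖hermiteComb J α y z‖ₑ ^ 2 ∂stdGaussianPi κ ≤ ENNReal.ofReal (N ^ 2)) :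
    stdGaussianPi κ {z | 3 * r ^ k * N < ‖hermiteComb J α y z‖}
      ≤ 2 * ENNReal.ofReal (Real.exp (-((r ^ 2 - 1) / 4))) := by
  have hr0 : 0 < r := by linarith
  set ρ := r⁻¹ with hρ
  set σ := √(1 - ρ ^ 2) with hσ_def
  have hρ0 : 0 < ρ := by positivity
  have hρ1 : ρ ^ 2 < 1 := by
    rw [hρ, inv_pow]; exact inv_lt_one_of_one_lt₀ (one_lt_pow₀ hr (by norm_num))
  have hσ : 0 < σ := Real.sqrt_pos.2 (by linarith)
  have hσ2 : σ ^ 2 = 1 - ρ ^ 2 := Real.sq_sqrt (by linarith)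
  have hρσ : ρ ^ 2 + σ ^ 2 = 1 := by rw [hσ2]; ring
  set Φ := hermiteComb J α y with hΦ_def
  have hΦc : Continuous Φ := continuous_hermiteComb
  set G : (κ → ℝ) → ℝ≥0∞ := fun w => ∫⁻ z, ‖Φ (ρ • w + σ • z)‖ₑ ^ 2 ∂stdGaussianPi κ with hG
  have hGm : Measurable G := by
    have : Measurable fun p : (κ → ℝ) × (κ → ℝ) => ‖Φ (ρ • p.1 + σ • p.2)‖ₑ ^ 2 :=
      Continuous.measurable (by fun_prop)
    exact this.lintegral_prod_right'
  have hGint : ∫⁻ w, G w ∂stdGaussianPi κ ≤ ENNReal.ofReal (N ^ 2) := by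
    have hm : Measurable fun z => ‖Φ z‖ₑ ^ 2 := Continuous.measurable (by fun_prop)
    simp only [hG]
    rw [lintegral_lintegral_mehler hρσ hm]
    exact hΦ
  set A' : Set (κ → ℝ) := {w | G w < ENNReal.ofReal (2 * N ^ 2)} with hA
  have hAm : MeasurableSet A' := measurableSet_lt hGm measurable_const
  have hA2 : 2⁻¹ ≤ stdGaussianPi κ A' := by
    have hc : stdGaussianPi κ A'ᶜ ≤ 2⁻¹ := by
      have h1 : A'ᶜ = {w | ENNReal.ofReal (2 * N ^ 2) ≤ G w} := by ext; simp [hA]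
      have h2 := meas_ge_le_lintegral_div (μ := stdGaussianPi κ) hGm.aemeasurable
        (ε := ENNReal.ofReal (2 * N ^ 2)) (by simp; positivity) ENNReal.ofReal_ne_top
      rw [h1]
      refine h2.trans ((ENNReal.div_le_div_right hGint _).trans ?_)
      rw [← ENNReal.ofReal_div_of_pos (by positivity)]
      refine le_trans (ENNReal.ofReal_le_ofReal (q := 2⁻¹) (le_of_eq ?_)) ?_
      · field_simp
      · rw [ENNReal.ofReal_inv_of_pos (by norm_num)]; simp
    have h3 := prob_add_prob_compl (μ := stdGaussianPi κ) hAm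
    by_contra hlt
    have h4 : stdGaussianPi κ A' + stdGaussianPi κ A'ᶜ < 2⁻¹ + 2⁻¹ :=
      ENNReal.add_lt_add_of_lt_of_le (ne_top_of_le_ne_top (by simp) hc) (not_le.1 hlt) hc
    rw [h3, ENNReal.inv_two_add_inv_two] at h4
    exact lt_irrefl _ h4
  set S : Set (κ → ℝ) := {z | 3 * r ^ k * N < ‖Φ z‖} with hS
  have hSm : MeasurableSet S := (isOpen_lt continuous_const hΦc.norm).measurableSet
  have key := stdGaussianPi_mul_le hAm hSm (q := (r ^ 2 - 1) / 4) (fun x hx w hw => by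
    have h1 := enorm_hermiteComb_le (y := y) hα hσ hρσ x w
    have hGw : G w < ENNReal.ofReal (2 * N ^ 2) := hw
    have h2 : ENNReal.ofReal (ρ ^ k * ‖Φ x‖) ≤
        ENNReal.ofReal (Real.exp ((ρ ^ 2 / σ ^ 2 * ∑ i, (x i - w i) ^ 2) / 2) * √(2 * N ^ 2)) := by
      calc ENNReal.ofReal (ρ ^ k * ‖Φ x‖) = ‖ρ ^ k • Φ x‖ₑ := by
            rw [← ofReal_norm, norm_smul, Real.norm_of_nonneg (by positivity)]
        _ ≤ _ := h1
        _ ≤ ENNReal.ofReal (Real.exp ((ρ ^ 2 / σ ^ 2 * ∑ i, (x i - w i) ^ 2) / 2)) *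
            ENNReal.ofReal (2 * N ^ 2) ^ (1 / 2 : ℝ) := by gcongr
        _ = _ := by
            rw [ENNReal.ofReal_rpow_of_pos (by positivity), ← Real.sqrt_eq_rpow,
              ENNReal.ofReal_mul (Real.exp_nonneg _)]
    rw [ENNReal.ofReal_le_ofReal_iff (by positivity)] at h2
    have hx' : 3 * r ^ k * N < ‖Φ x‖ := hx
    have h3 : 3 * N < ρ ^ k * ‖Φ x‖ := by
      have : ρ ^ k * (3 * r ^ k * N) = 3 * N := by
        rw [hρ, inv_pow]; field_simp
      rw [← this]
      exact mul_lt_mul_of_pos_left hx' (by positivity)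
    set E := (ρ ^ 2 / σ ^ 2 * ∑ i, (x i - w i) ^ 2) / 2 with hE
    have h4 : (3 * N) ^ 2 < (Real.exp E * √(2 * N ^ 2)) ^ 2 :=
      pow_lt_pow_left₀ (h3.trans_le h2) (by positivity) (by norm_num)
    rw [mul_pow, mul_pow, Real.sq_sqrt (by positivity), ← Real.exp_nat_mul] at h4
    have h5 : Real.exp 1 < Real.exp ((2 : ℕ) * E) := by
      have h6 : 9 < 2 * Real.exp ((2 : ℕ) * E) := by
        have hN2 : 0 < N ^ 2 := by positivity
        nlinarith
      linarith [Real.exp_one_lt_d9]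
    have h6 : 1 < 2 * E := by simpa using Real.exp_lt_exp.1 h5
    have h7 : 1 < ρ ^ 2 / σ ^ 2 * ∑ i, (x i - w i) ^ 2 := by rw [hE] at h6; linarith
    rw [div_mul_eq_mul_div, one_lt_div (by positivity), hσ2] at h7
    have h8 : r ^ 2 * (1 - ρ ^ 2) < r ^ 2 * (ρ ^ 2 * ∑ i, (x i - w i) ^ 2) :=
      mul_lt_mul_of_pos_left h7 (by positivity)
    have h9 : r ^ 2 * ρ ^ 2 = 1 := by rw [hρ]; field_simp
    rw [← mul_assoc, h9, mul_sub, h9] at h8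
    linarith)
  calc stdGaussianPi κ S = 2 * (stdGaussianPi κ S * 2⁻¹) := by
        rw [mul_comm, mul_assoc, ENNReal.inv_mul_cancel (by simp) (by simp), mul_one]
    _ ≤ 2 * (stdGaussianPi κ S * stdGaussianPi κ A') := by gcongr
    _ ≤ _ := by gcongr

end HermiteProd

section ChaosTail

theorem lintegral_enorm_sq_Lp {Ω F : Type*} [MeasurableSpace Ω] {μ : Measure Ω}
    [NormedAddCommGroup F] (f : Lp F 2 μ) :
    ∫⁻ ξ, ‖f ξ‖ₑ ^ 2 ∂μ = ENNReal.ofReal (‖f‖ ^ 2) := by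
  rw [ENNReal.ofReal_pow (norm_nonneg _), ofReal_norm, Lp.enorm_def,
    eLpNorm_eq_lintegral_rpow_enorm_toReal (by simp) (by simp)]
  simp only [ENNReal.toReal_ofNat, ENNReal.rpow_ofNat]
  rw [← ENNReal.rpow_natCast, ← ENNReal.rpow_mul]
  norm_num

variable {B H : Type*} [NormedAddCommGroup B] [NormedSpace ℝ B] [CompleteSpace B]
  [SecondCountableTopology B] [MeasurableSpace B] [BorelSpace B]
  [NormedAddCommGroup H] [InnerProductSpace ℝ H] [CompleteSpace H]
  {j : H →L[ℝ] B} {μ : Measure B} {ι : Type*} {e : ι → StrongDual ℝ B} {b : HilbertBasis ι ℝ H}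
  {F : Type*} [NormedAddCommGroup F] [NormedSpace ℝ F]

theorem inner_dualToH (j : H →L[ℝ] B) (ℓ : StrongDual ℝ B) (h : H) :
    inner ℝ (dualToH j ℓ) h = ℓ (j h) := by
  simp [dualToH]

/-- The finitely many coordinates `⟨ξ, e i⟩`, `i ∈ s`. -/
def coords (e : ι → StrongDual ℝ B) (s : Finset ι) : B →L[ℝ] (s → ℝ) :=
  ContinuousLinearMap.pi fun i : s => e i

@[simp]
theorem coords_apply (e : ι → StrongDual ℝ B) (s : Finset ι) (ξ : B) (i : s) :
    coords e s ξ i = e i ξ := rfl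

theorem map_coords (hμ : IsAbstractWienerSpace j μ) (hb : ∀ i, b i = dualToH j (e i))
    (s : Finset ι) : μ.map (coords e s) = stdGaussianPi s := by
  have := hμ.isGaussian
  have hcov : ∀ i k, ∫ ξ, e i ξ * e k ξ ∂μ = inner ℝ (b i) (b k) := by
    intro i k; rw [hμ.covariance, hb, hb]
  have hlaw : HasGaussianLaw (fun (ξ : B) (i : s) => e i ξ) μ :=
    (IsGaussian.hasGaussianLaw_id (μ := μ)).map_fun (coords e s)
  have hind : iIndepFun (fun (i : s) (ξ : B) => e i ξ) μ := by
    refine hlaw.iIndepFun_of_covariance_eq_zero fun i k hik => ?_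
    rw [covariance_dual_of_centred hμ.centred, hcov]
    exact b.orthonormal.2 (fun h => hik (Subtype.ext h))
  have hpi := (iIndepFun_iff_map_fun_eq_pi_map fun i : s => by fun_prop).1 hind
  have h1 : ∀ i : s, μ.map (fun ξ => e i ξ) = stdNormal := by
    intro i
    rw [map_dual_eq_gaussianReal hμ.centred (e i), hcov, real_inner_self_eq_norm_sq,
      b.orthonormal.1]
    simp
  simp_rw [h1] at hpi
  exact hpi

theorem hermiteMulti_eq_hermiteProd (e : ι → StrongDual ℝ B) {α : ι →₀ ℕ} {s : Finset ι}
    (hs : α.support ⊆ s) (ξ : B) :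
    hermiteMulti e α ξ = hermiteProd (fun i : s => α i) (coords e s ξ) := by
  rw [hermiteMulti, Finsupp.prod_of_support_subset _ hs]
  · rw [hermiteProd, ← Finset.prod_coe_sort]
    rfl
  · intro i _
    simp [hermiteFun]

theorem sum_coe_eq_degree {α : ι →₀ ℕ} {s : Finset ι} (hs : α.support ⊆ s) :
    ∑ i : s, α i = α.degree := by
  rw [Finsupp.degree_apply, Finset.sum_coe_sort s (fun i => α i)]
  exact (Finset.sum_subset hs fun i _ hi => by simpa using hi).symm

/-- The random variable `∑ α, H_α(ξ) c_α`. -/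
def chaosComb (e : ι → StrongDual ℝ B) (c : (ι →₀ ℕ) →₀ F) (ξ : B) : F :=
  c.sum fun α y => hermiteMulti e α ξ • y

theorem chaosComb_eq_hermiteComb (e : ι → StrongDual ℝ B) {c : (ι →₀ ℕ) →₀ F} {s : Finset ι}
    (hs : ∀ α ∈ c.support, α.support ⊆ s) (ξ : B) :
    chaosComb e c ξ = hermiteComb c.support (fun α (i : s) => α i) c (coords e s ξ) := by
  rw [chaosComb, Finsupp.sum, hermiteComb]
  exact Finset.sum_congr rfl fun α hα => by rw [hermiteMulti_eq_hermiteProd e (hs α hα)]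

theorem exists_support_subset (c : (ι →₀ ℕ) →₀ F) :
    ∃ s : Finset ι, ∀ α ∈ c.support, α.support ⊆ s := by
  classical
  exact ⟨c.support.biUnion Finsupp.support, fun α hα => Finset.subset_biUnion_of_mem _ hα⟩

theorem exists_chaosComb_of_mem_span {k : ℕ} {f : Lp F 2 μ}
    (hf : f ∈ Submodule.span ℝ {f : Lp F 2 μ | ∃ (α : ι →₀ ℕ) (y : F),
      α.degree = k ∧ f =ᵐ[μ] fun ξ => hermiteMulti e α ξ • y}) :
    ∃ c : (ι →₀ ℕ) →₀ F, (∀ α ∈ c.support, α.degree = k) ∧ f =ᵐ[μ] chaosComb e c := by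
  classical
  induction hf using Submodule.span_induction with
  | mem f hf =>
    obtain ⟨α, y, hα, hf⟩ := hf
    refine ⟨Finsupp.single α y, fun β hβ => ?_, ?_⟩
    · rw [Finset.mem_singleton.1 (Finsupp.support_single_subset hβ), hα]
    · filter_upwards [hf] with ξ hξ
      rw [hξ, chaosComb, Finsupp.sum_single_index (by simp)]
  | zero =>
    refine ⟨0, by simp, ?_⟩
    filter_upwards [Lp.coeFn_zero F 2 μ] with ξ hξ
    rw [hξ]
    simp [chaosComb]
  | add f g _ _ hf hg =>
    obtain ⟨c, hc, hfc⟩ := hf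
    obtain ⟨d, hd, hgd⟩ := hg
    refine ⟨c + d, fun α hα => ?_, ?_⟩
    · rcases Finset.mem_union.1 (Finsupp.support_add hα) with h | h
      · exact hc α h
      · exact hd α h
    · filter_upwards [Lp.coeFn_add f g, hfc, hgd] with ξ h1 h2 h3
      rw [h1, Pi.add_apply, h2, h3]
      simp only [chaosComb]
      rw [Finsupp.sum_add_index' (by simp) (by simp [smul_add])]
  | smul a f _ hf =>
    obtain ⟨c, hc, hfc⟩ := hf
    refine ⟨a • c, fun α hα => hc α (Finsupp.support_smul hα), ?_⟩
    filter_upwards [Lp.coeFn_smul a f, hfc] with ξ h1 h2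
    rw [h1, Pi.smul_apply, h2]
    simp only [chaosComb]
    rw [Finsupp.sum_smul_index' (by simp), Finsupp.smul_sum]
    exact Finsupp.sum_congr fun α _ => smul_comm _ _ _

theorem exists_chaosComb_norm_sub_lt {k : ℕ} {f : Lp F 2 μ} (hf : f ∈ chaos μ e F k) {η : ℝ}
    (hη : 0 < η) :
    ∃ (g : Lp F 2 μ) (c : (ι →₀ ℕ) →₀ F), g ∈ chaos μ e F k ∧ ‖f - g‖ < η ∧
      (∀ α ∈ c.support, α.degree = k) ∧ g =ᵐ[μ] chaosComb e c := by
  obtain ⟨g, hg, hfg⟩ := Metric.mem_closure_iff.1 hf η hη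
  obtain ⟨c, hc, hgc⟩ := exists_chaosComb_of_mem_span hg
  exact ⟨g, c, Submodule.le_topologicalClosure _ hg, by rwa [← dist_eq_norm], hc, hgc⟩

theorem chaosComb_tail [CompleteSpace F] (hμ : IsAbstractWienerSpace j μ)
    (hb : ∀ i, b i = dualToH j (e i)) {k : ℕ} {f : Lp F 2 μ} {c : (ι →₀ ℕ) →₀ F}
    (hc : ∀ α ∈ c.support, α.degree = k) (hf : f =ᵐ[μ] chaosComb e c) {r N : ℝ} (hr : 1 < r)
    (hN : 0 < N) (hfN : ‖f‖ ≤ N) :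
    μ {ξ | 3 * r ^ k * N < ‖f ξ‖} ≤ 2 * ENNReal.ofReal (Real.exp (-((r ^ 2 - 1) / 4))) := by
  obtain ⟨s, hs⟩ := exists_support_subset c
  set Φ := hermiteComb c.support (fun α (i : s) => α i) c with hΦ
  have hΦc : Continuous Φ := continuous_hermiteComb
  have hfΦ : f =ᵐ[μ] fun ξ => Φ (coords e s ξ) := by
    filter_upwards [hf] with ξ hξ
    rw [hξ, chaosComb_eq_hermiteComb e hs]
  have hm : Measurable (coords e s) := (coords e s).continuous.measurable
  have key := stdGaussianPi_hermiteComb_tail (J := c.support) (α := fun α (i : s) => α i) (y := c)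
    (k := k) (fun α hα => by rw [sum_coe_eq_degree (hs α hα), hc α hα]) hr hN (by
      rw [← map_coords hμ hb, lintegral_map (Continuous.measurable (by fun_prop)) hm]
      calc _ = ∫⁻ ξ, ‖f ξ‖ₑ ^ 2 ∂μ := by
            refine lintegral_congr_ae ?_
            filter_upwards [hfΦ] with ξ hξ
            rw [hξ]
        _ = ENNReal.ofReal (‖f‖ ^ 2) := lintegral_enorm_sq_Lp f
        _ ≤ _ := by gcongr)
  rw [← map_coords hμ hb, Measure.map_apply hm
    (isOpen_lt continuous_const hΦc.norm).measurableSet] at key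
  refine le_trans (measure_mono_ae ?_) key
  filter_upwards [hfΦ] with ξ hξ h
  have h' : 3 * r ^ k * N < ‖f ξ‖ := h
  rw [hξ] at h'
  exact h'

/-- Gaussian-chaos tails: `‖f‖` exceeds `6 r ^ k ‖f‖_{L²}` with probability at most
`2 exp (-(r ^ 2 - 1) / 4)` if `f` belongs to the `k`-th chaos. -/
theorem chaos_tail [CompleteSpace F] (hμ : IsAbstractWienerSpace j μ)
    (hb : ∀ i, b i = dualToH j (e i)) {k : ℕ} {f : Lp F 2 μ} (hf : f ∈ chaos μ e F k) {r N : ℝ}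
    (hr : 1 < r) (hfN : ‖f‖ < N) :
    μ {ξ | 6 * r ^ k * N < ‖f ξ‖} ≤ 2 * ENNReal.ofReal (Real.exp (-((r ^ 2 - 1) / 4))) := by
  have hN : 0 < N := (norm_nonneg f).trans_lt hfN
  have hr0 : 0 < r := by linarith
  have hpos : 0 < 3 * r ^ k * N := by positivity
  choose! g c hg using fun n : ℕ => exists_chaosComb_norm_sub_lt hf
    (η := min (N - ‖f‖) (1 / ((n : ℝ) + 1))) (lt_min (by linarith) (by positivity))
  have hgf : Tendsto g atTop (𝓝 f) := by
    rw [tendsto_iff_norm_sub_tendsto_zero]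
    refine squeeze_zero (fun n => norm_nonneg _) (fun n => ?_) tendsto_one_div_add_atTop_nhds_zero_nat
    rw [norm_sub_rev]
    exact ((hg n).2.1.trans_le (min_le_right _ _)).le
  have hmeas := tendstoInMeasure_of_tendsto_Lp hgf (ENNReal.ofReal (3 * r ^ k * N)) (by simpa using hpos)
  have hlim : Tendsto (fun n => 2 * ENNReal.ofReal (Real.exp (-((r ^ 2 - 1) / 4)))
      + μ {ξ | ENNReal.ofReal (3 * r ^ k * N) ≤ edist (g n ξ) (f ξ)}) atTop
      (𝓝 (2 * ENNReal.ofReal (Real.exp (-((r ^ 2 - 1) / 4))) + 0)) :=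
    hmeas.const_add _
  rw [add_zero] at hlim
  refine ge_of_tendsto' hlim fun n => ?_
  have hgN : ‖g n‖ ≤ N := by
    have h1 := (hg n).2.1.trans_le (min_le_left _ _)
    have h2 := norm_sub_norm_le (g n) f
    rw [norm_sub_rev] at h2
    linarith
  refine le_trans ?_ (add_le_add (chaosComb_tail hμ hb (hg n).2.2.1 (hg n).2.2.2 hr hN hgN) le_rfl)
  refine (measure_mono fun ξ hξ => ?_).trans (measure_union_le _ _)
  by_contra hcon
  simp only [Set.mem_union, not_or] at hcon
  have h1 : ¬ 3 * r ^ k * N < ‖g n ξ‖ := hcon.1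
  have h2 : ¬ ENNReal.ofReal (3 * r ^ k * N) ≤ edist (g n ξ) (f ξ) := hcon.2
  have h3 : 6 * r ^ k * N < ‖f ξ‖ := hξ
  rw [edist_dist, ENNReal.ofReal_le_ofReal_iff dist_nonneg, dist_eq_norm, not_le] at h2
  have h4 := norm_sub_norm_le (f ξ) (g n ξ)
  rw [norm_sub_rev] at h4
  linarith

end ChaosTail

section HomPart

variable {B H : Type*} [NormedAddCommGroup B] [NormedSpace ℝ B] [CompleteSpace B]
  [SecondCountableTopology B] [MeasurableSpace B] [BorelSpace B]
  [NormedAddCommGroup H] [InnerProductSpace ℝ H] [CompleteSpace H]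
  {j : H →L[ℝ] B} {μ : Measure B} {ι : Type*} {e : ι → StrongDual ℝ B} {b : HilbertBasis ι ℝ H}
  {F : Type*} [NormedAddCommGroup F] [NormedSpace ℝ F]

theorem dualToH_sum (hb : ∀ i, b i = dualToH j (e i)) (s : Finset ι) (c : ι → ℝ) :
    dualToH j (∑ i ∈ s, c i • e i) = ∑ i ∈ s, c i • b i := by
  refine ext_inner_right ℝ fun x => ?_
  rw [inner_dualToH, sum_inner]
  simp [real_inner_smul_left, hb, inner_dualToH]

theorem mem_closure_range_dualToH (hb : ∀ i, b i = dualToH j (e i)) (h : H) :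
    h ∈ closure (Set.range (dualToH j)) := by
  refine mem_closure_of_tendsto (b.hasSum_repr h) (Eventually.of_forall fun s => ?_)
  exact ⟨∑ i ∈ s, b.repr h i • e i, dualToH_sum hb s _⟩

theorem lintegral_add_dualToH_le (hμ : IsAbstractWienerSpace j μ) (ℓ : StrongDual ℝ B)
    {f : B → ℝ≥0∞} (hf : Measurable f) :
    ∫⁻ ξ, f (ξ + j (dualToH j ℓ)) ∂μ ≤ ENNReal.ofReal (Real.exp (‖dualToH j ℓ‖ ^ 2 / 2)) *
      (∫⁻ ξ, f ξ ^ 2 ∂μ) ^ (1 / 2 : ℝ) := by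
  have := hμ.isGaussian
  have h := lintegral_add_const_le hμ.centred ℓ (j (dualToH j ℓ))
    (fun L => by rw [hμ.covariance, inner_dualToH]) hf
  rwa [← inner_dualToH, real_inner_self_eq_norm_sq] at h

theorem lintegral_add_le_of_lowerSemicontinuous (hμ : IsAbstractWienerSpace j μ)
    (hb : ∀ i, b i = dualToH j (e i)) (h : H) {f : B → ℝ≥0∞} (hf : LowerSemicontinuous f) :
    ∫⁻ ξ, f (ξ + j h) ∂μ ≤ ENNReal.ofReal (Real.exp (‖h‖ ^ 2 / 2)) *
      (∫⁻ ξ, f ξ ^ 2 ∂μ) ^ (1 / 2 : ℝ) := by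
  obtain ⟨g, hg, hgh⟩ := mem_closure_iff_seq_limit.1 (mem_closure_range_dualToH hb h)
  choose ℓ hℓ using hg
  have hlim : Tendsto (fun n => ENNReal.ofReal (Real.exp (‖g n‖ ^ 2 / 2)) *
      (∫⁻ ξ, f ξ ^ 2 ∂μ) ^ (1 / 2 : ℝ)) atTop (𝓝 (ENNReal.ofReal (Real.exp (‖h‖ ^ 2 / 2)) *
      (∫⁻ ξ, f ξ ^ 2 ∂μ) ^ (1 / 2 : ℝ))) := by
    refine ENNReal.Tendsto.mul_const (ENNReal.tendsto_ofReal ?_) (Or.inl ?_)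
    · exact (Real.continuous_exp.tendsto _).comp ((hgh.norm.pow 2).div_const 2)
    · simpa using Real.exp_pos _
  calc ∫⁻ ξ, f (ξ + j h) ∂μ ≤ ∫⁻ ξ, liminf (fun n => f (ξ + j (g n))) atTop ∂μ := by
        refine lintegral_mono fun ξ => ?_
        have h1 : Tendsto (fun n => ξ + j (g n)) atTop (𝓝 (ξ + j h)) :=
          ((j.continuous.tendsto h).comp hgh).const_add ξ
        exact le_of_forall_lt_imp_le_of_dense fun c hc => le_liminf_of_le (by isBoundedDefault)
          ((h1.eventually (hf _ c hc)).mono fun n hn => hn.le)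
    _ ≤ liminf (fun n => ∫⁻ ξ, f (ξ + j (g n)) ∂μ) atTop :=
        lintegral_liminf_le fun n => hf.measurable.comp (measurable_add_const _)
    _ ≤ liminf (fun n => ENNReal.ofReal (Real.exp (‖g n‖ ^ 2 / 2)) *
        (∫⁻ ξ, f ξ ^ 2 ∂μ) ^ (1 / 2 : ℝ)) atTop := by
        refine liminf_le_liminf (Eventually.of_forall fun n => ?_)
        rw [← hℓ n]
        exact lintegral_add_dualToH_le hμ (ℓ n) hf.measurable
    _ = _ := hlim.liminf_eq

/-- Translates by Cameron-Martin vectors act boundedly from `L²(μ)` to `L¹(μ)`. -/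
theorem lintegral_add_le (hμ : IsAbstractWienerSpace j μ)
    (hb : ∀ i, b i = dualToH j (e i)) (h : H) {f : B → ℝ≥0∞} (hf : Measurable f) :
    ∫⁻ ξ, f (ξ + j h) ∂μ ≤ ENNReal.ofReal (Real.exp (‖h‖ ^ 2 / 2)) *
      (∫⁻ ξ, f ξ ^ 2 ∂μ) ^ (1 / 2 : ℝ) := by
  have := hμ.isGaussian
  have key : ∀ n : ℕ, ∫⁻ ξ, f (ξ + j h) ∂μ ≤ ENNReal.ofReal (Real.exp (‖h‖ ^ 2 / 2)) *
      (∫⁻ ξ, f ξ ^ 2 ∂μ + ((n : ℝ≥0∞) + 1)⁻¹) ^ (1 / 2 : ℝ) := by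
    intro n
    obtain ⟨g, hfg, hg, hgint⟩ := exists_le_lowerSemicontinuous_lintegral_ge μ
      (fun ξ => f ξ ^ 2) (hf.pow_const 2) (ε := ((n : ℝ≥0∞) + 1)⁻¹) (by simp)
    have hmono : Monotone fun x : ℝ≥0∞ => x ^ (1 / 2 : ℝ) :=
      fun x y hxy => ENNReal.rpow_le_rpow hxy (by norm_num)
    have hgs : LowerSemicontinuous fun ξ => g ξ ^ (1 / 2 : ℝ) :=
      ENNReal.continuous_rpow_const.comp_lowerSemicontinuous hg hmono
    have hsq : ∀ x : ℝ≥0∞, (x ^ (1 / 2 : ℝ)) ^ 2 = x := by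
      intro x; rw [← ENNReal.rpow_natCast, ← ENNReal.rpow_mul]; norm_num
    have hsq' : ∀ x : ℝ≥0∞, (x ^ 2) ^ (1 / 2 : ℝ) = x := by
      intro x; rw [← ENNReal.rpow_natCast, ← ENNReal.rpow_mul]; norm_num
    calc ∫⁻ ξ, f (ξ + j h) ∂μ ≤ ∫⁻ ξ, g (ξ + j h) ^ (1 / 2 : ℝ) ∂μ := by
          refine lintegral_mono fun ξ => ?_
          have := hmono (hfg (ξ + j h))
          simpa only [hsq'] using this
      _ ≤ _ := lintegral_add_le_of_lowerSemicontinuous hμ hb h hgs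
      _ ≤ _ := by
          simp only [hsq]
          gcongr
  have hlim : Tendsto (fun n : ℕ => ENNReal.ofReal (Real.exp (‖h‖ ^ 2 / 2)) *
      (∫⁻ ξ, f ξ ^ 2 ∂μ + ((n : ℝ≥0∞) + 1)⁻¹) ^ (1 / 2 : ℝ)) atTop
      (𝓝 (ENNReal.ofReal (Real.exp (‖h‖ ^ 2 / 2)) *
        (∫⁻ ξ, f ξ ^ 2 ∂μ + 0) ^ (1 / 2 : ℝ))) := by
    refine ENNReal.Tendsto.const_mul ?_ (Or.inr ENNReal.ofReal_ne_top)
    refine (ENNReal.continuous_rpow_const.tendsto _).comp ?_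
    refine Tendsto.const_add _ ?_
    have := (tendsto_add_atTop_iff_nat 1).2 ENNReal.tendsto_inv_nat_nhds_zero
    simpa using this
  rw [add_zero] at hlim
  exact ge_of_tendsto' hlim key

theorem quasiMeasurePreserving_add (hμ : IsAbstractWienerSpace j μ)
    (hb : ∀ i, b i = dualToH j (e i)) (h : H) :
    Measure.QuasiMeasurePreserving (fun ξ => ξ + j h) μ μ := by
  refine ⟨measurable_add_const _, Measure.AbsolutelyContinuous.mk fun A hA hA0 => ?_⟩
  rw [Measure.map_apply (measurable_add_const _) hA]
  have := lintegral_add_le hμ hb h (f := A.indicator 1) (measurable_one.indicator hA)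
  have h1 : ∫⁻ ξ, A.indicator (1 : B → ℝ≥0∞) ξ ^ 2 ∂μ = 0 := by
    have : ∀ ξ, A.indicator (1 : B → ℝ≥0∞) ξ ^ 2 = A.indicator 1 ξ := by
      intro ξ; by_cases hξ : ξ ∈ A <;> simp [hξ]
    simp_rw [this]
    rw [lintegral_indicator_one hA, hA0]
  have h2 : ∫⁻ ξ, A.indicator (1 : B → ℝ≥0∞) (ξ + j h) ∂μ = μ ((fun ξ => ξ + j h) ⁻¹' A) := by
    rw [← lintegral_indicator_one (measurable_add_const _ hA)]
    rfl
  rw [h1, h2] at this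
  simpa using this

theorem lintegral_enorm_add_le (hμ : IsAbstractWienerSpace j μ)
    (hb : ∀ i, b i = dualToH j (e i)) (h : H) (f : Lp F 2 μ) :
    ∫⁻ ξ, ‖f (ξ + j h)‖ₑ ∂μ ≤ ENNReal.ofReal (Real.exp (‖h‖ ^ 2 / 2) * ‖f‖) := by
  have hae : AEMeasurable (fun ξ => ‖f ξ‖ₑ) μ := (Lp.aestronglyMeasurable f).enorm
  have h1 := (quasiMeasurePreserving_add hμ hb h).ae_eq_comp hae.ae_eq_mk
  rw [lintegral_congr_ae (show (fun ξ => ‖f (ξ + j h)‖ₑ) =ᵐ[μ] fun ξ => hae.mk _ (ξ + j h) from h1)]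
  refine (lintegral_add_le hμ hb h hae.measurable_mk).trans (le_of_eq ?_)
  have h2 : ∫⁻ ξ, hae.mk _ ξ ^ 2 ∂μ = ∫⁻ ξ, ‖f ξ‖ₑ ^ 2 ∂μ := by
    refine lintegral_congr_ae ?_
    filter_upwards [hae.ae_eq_mk] with ξ hξ
    rw [← hξ]
  rw [h2, lintegral_enorm_sq_Lp, ENNReal.ofReal_rpow_of_nonneg (by positivity) (by norm_num),
    ← Real.sqrt_eq_rpow, Real.sqrt_sq (norm_nonneg _), ENNReal.ofReal_mul (Real.exp_nonneg _)]

theorem integrable_add (hμ : IsAbstractWienerSpace j μ)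
    (hb : ∀ i, b i = dualToH j (e i)) (h : H) (f : Lp F 2 μ) :
    Integrable (fun ξ => f (ξ + j h)) μ :=
  ⟨(Lp.aestronglyMeasurable f).comp_quasiMeasurePreserving (quasiMeasurePreserving_add hμ hb h),
    (lintegral_enorm_add_le hμ hb h f).trans_lt ENNReal.ofReal_lt_top⟩

theorem norm_integral_add_sub_le (hμ : IsAbstractWienerSpace j μ)
    (hb : ∀ i, b i = dualToH j (e i)) (h : H) (f g : Lp F 2 μ) :
    ‖∫ ξ, f (ξ + j h) ∂μ - ∫ ξ, g (ξ + j h) ∂μ‖ ≤ Real.exp (‖h‖ ^ 2 / 2) * ‖f - g‖ := by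
  have h1 := (quasiMeasurePreserving_add hμ hb h).ae_eq_comp (Lp.coeFn_sub f g)
  rw [← integral_sub (integrable_add hμ hb h f) (integrable_add hμ hb h g)]
  rw [integral_congr_ae (show (fun ξ => f (ξ + j h) - g (ξ + j h)) =ᵐ[μ]
    fun ξ => (f - g) (ξ + j h) from h1.symm)]
  have h2 := (enorm_integral_le_lintegral_enorm _).trans (lintegral_enorm_add_le hμ hb h (f - g))
  rw [← ofReal_norm] at h2
  exact (ENNReal.ofReal_le_ofReal_iff (by positivity)).1 h2

/-- The leading part of a combination of Hermite polynomials. -/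
def monomialComb {κ A : Type*} [Fintype κ] (J : Finset A) (α : A → κ → ℕ) (y : A → F)
    (z : κ → ℝ) : F :=
  ∑ a ∈ J, (∏ i, z i ^ α a i / √((α a i).factorial : ℝ)) • y a

theorem integral_chaosComb_add [CompleteSpace F] (hμ : IsAbstractWienerSpace j μ)
    (hb : ∀ i, b i = dualToH j (e i)) (h : H) {f : Lp F 2 μ} {c : (ι →₀ ℕ) →₀ F}
    (hf : f =ᵐ[μ] chaosComb e c) {s : Finset ι} (hs : ∀ α ∈ c.support, α.support ⊆ s) :
    ∫ ξ, f (ξ + j h) ∂μ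
      = monomialComb c.support (fun α (i : s) => α i) c (coords e s (j h)) := by
  have h1 := (quasiMeasurePreserving_add hμ hb h).ae_eq_comp hf
  rw [integral_congr_ae (show (fun ξ => f (ξ + j h)) =ᵐ[μ] fun ξ => chaosComb e c (ξ + j h) from h1)]
  simp_rw [chaosComb_eq_hermiteComb e hs, map_add]
  rw [← integral_map (φ := coords e s) (μ := μ) (coords e s).continuous.aemeasurable
    (f := fun z => hermiteComb c.support (fun α (i : s) => α i) c (z + coords e s (j h)))
    (Continuous.aestronglyMeasurable (by fun_prop)), map_coords hμ hb]
  simp only [hermiteComb, monomialComb]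
  rw [integral_finsetSum]
  · refine Finset.sum_congr rfl fun α _ => ?_
    rw [integral_smul_const, integral_hermiteProd_add]
  · intro α _
    refine Integrable.smul_const ?_ _
    simpa [add_comm] using integrable_hermiteProd_affine (fun i : s => α i) (coords e s (j h)) 1

end HomPart

section ExponentialScale

theorem mul_log_ofReal_exp {ε : ℝ} (hε : 0 < ε) (a : ℝ) :
    (ε : EReal) * ENNReal.log (ENNReal.ofReal (Real.exp (-a / ε))) = ((-a : ℝ) : EReal) := by
  rw [ENNReal.log_ofReal, if_neg (not_le.2 (Real.exp_pos _)), Real.log_exp, ← EReal.coe_mul]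
  congr 1
  field_simp

theorem limsup_mul_log_le {m : ℝ → ℝ≥0∞} {L : EReal}
    (h : ∀ a : ℝ, (a : EReal) < L → ∀ᶠ ε in 𝓝[>] (0 : ℝ), m ε ≤ ENNReal.ofReal (Real.exp (-a / ε))) :
    limsup (fun ε : ℝ => (ε : EReal) * ENNReal.log (m ε)) (𝓝[>] 0) ≤ -L := by
  refine EReal.le_neg_of_le_neg (EReal.ge_of_forall_gt_iff_ge.1 fun a ha => ?_)
  refine EReal.le_neg_of_le_neg (limsup_le_of_le (by isBoundedDefault) ?_)
  filter_upwards [h a ha, self_mem_nhdsWithin] with ε hm hε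
  rw [← EReal.coe_neg, ← mul_log_ofReal_exp hε a]
  exact mul_le_mul_of_nonneg_left (ENNReal.log_le_log hm) (EReal.coe_nonneg.2 (le_of_lt hε))

theorem le_liminf_mul_log {m : ℝ → ℝ≥0∞} {L : EReal}
    (h : ∀ a : ℝ, L < (a : EReal) → ∀ᶠ ε in 𝓝[>] (0 : ℝ), ENNReal.ofReal (Real.exp (-a / ε)) ≤ m ε) :
    -L ≤ liminf (fun ε : ℝ => (ε : EReal) * ENNReal.log (m ε)) (𝓝[>] 0) := by
  refine EReal.neg_le_of_neg_le (EReal.le_of_forall_lt_iff_le.1 fun a ha => ?_)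
  refine EReal.neg_le_of_neg_le (le_liminf_of_le (by isBoundedDefault) ?_)
  filter_upwards [h a ha, self_mem_nhdsWithin] with ε hm hε
  rw [← EReal.coe_neg, ← mul_log_ofReal_exp hε a]
  exact mul_le_mul_of_nonneg_left (ENNReal.log_le_log hm) (EReal.coe_nonneg.2 (le_of_lt hε))

/-- Constants are negligible on the exponential scale. -/
theorem eventually_const_mul_exp_le (A : ℝ) {a a' : ℝ} (h : a' < a) :
    ∀ᶠ ε in 𝓝[>] (0 : ℝ), A * Real.exp (-a / ε) ≤ Real.exp (-a' / ε) := by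
  have h1 : Tendsto (fun ε : ℝ => Real.exp ((a - a') * ε⁻¹)) (𝓝[>] 0) atTop :=
    Real.tendsto_exp_atTop.comp (tendsto_inv_nhdsGT_zero.const_mul_atTop (by linarith))
  filter_upwards [h1.eventually_ge_atTop A] with ε hε
  calc A * Real.exp (-a / ε) ≤ Real.exp ((a - a') * ε⁻¹) * Real.exp (-a / ε) := by gcongr
    _ = _ := by rw [← Real.exp_add]; congr 1; ring

end ExponentialScale

section FiniteDimensional

variable {κ : Type*} [Fintype κ]

theorem integrable_exp_sq_stdNormal {θ : ℝ} (hθ : θ < 1) :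
    Integrable (fun x : ℝ => Real.exp (θ * x ^ 2 / 2)) stdNormal := by
  rw [stdNormal, gaussianReal_of_var_ne_zero 0 one_ne_zero,
    integrable_withDensity_iff (measurable_gaussianPDF 0 1) (ae_of_all _ fun x =>
      gaussianPDF_lt_top)]
  have := (integrable_exp_neg_mul_sq (b := (1 - θ) / 2) (by linarith)).const_mul (√(2 * Real.pi))⁻¹
  refine this.congr (ae_of_all _ fun x => ?_)
  simp only [toReal_gaussianPDF, gaussianPDFReal_def, NNReal.coe_one, mul_one, sub_zero]
  rw [mul_left_comm, ← Real.exp_add]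
  congr 2
  ring

theorem stdGaussianPi_tail {a a' : ℝ} (ha : a' < a) (ha' : 0 ≤ a') :
    ∀ᶠ ε in 𝓝[>] (0 : ℝ), stdGaussianPi κ {z | 2 * a < ∑ i, (√ε * z i) ^ 2}
      ≤ ENNReal.ofReal (Real.exp (-a' / ε)) := by
  have ha0 : 0 < a := by linarith
  set θ := (a' / a + 1) / 2 with hθ
  have h1 : a' / a < 1 := (div_lt_one ha0).2 ha
  have h0 : 0 ≤ a' / a := by positivity
  have hθ1 : θ < 1 := by rw [hθ]; linarith
  have hθ0 : 0 < θ := by rw [hθ]; linarith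
  have hθa : a' < θ * a := by
    have : a' / a < θ := by rw [hθ]; linarith
    rwa [div_lt_iff₀ ha0] at this
  have hint : Integrable (fun z : κ → ℝ => Real.exp (θ * (∑ i, z i ^ 2) / 2)) (stdGaussianPi κ) := by
    have := Integrable.fintype_prod (μ := fun _ : κ => stdNormal)
      (f := fun _ t => Real.exp (θ * t ^ 2 / 2)) fun _ => integrable_exp_sq_stdNormal hθ1
    refine this.congr (ae_of_all _ fun z => ?_)
    simp only
    rw [← Real.exp_sum, Finset.mul_sum, Finset.sum_div]
  set A := ∫ z : κ → ℝ, Real.exp (θ * (∑ i, z i ^ 2) / 2) ∂stdGaussianPi κ with hA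
  filter_upwards [eventually_const_mul_exp_le A hθa, self_mem_nhdsWithin] with ε hε hε0
  have hε0 : 0 < ε := hε0
  have hmk := mul_meas_ge_le_integral_of_nonneg (ae_of_all _ fun z => Real.exp_nonneg _) hint
    (Real.exp (θ * a / ε))
  have hsub : {z : κ → ℝ | 2 * a < ∑ i, (√ε * z i) ^ 2}
      ⊆ {z | Real.exp (θ * a / ε) ≤ Real.exp (θ * (∑ i, z i ^ 2) / 2)} := by
    intro z hz
    have hz : 2 * a < ∑ i, (√ε * z i) ^ 2 := hz
    simp_rw [mul_pow, Real.sq_sqrt hε0.le, ← Finset.mul_sum] at hz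
    refine Real.exp_le_exp.2 ?_
    rw [mul_div_assoc, mul_div_assoc]
    refine mul_le_mul_of_nonneg_left ?_ hθ0.le
    rw [div_le_div_iff₀ hε0 (by norm_num)]
    linarith
  refine (measure_mono hsub).trans ?_
  rw [← ofReal_measureReal]
  refine ENNReal.ofReal_le_ofReal (le_trans ?_ hε)
  rw [neg_div, Real.exp_neg, ← div_eq_mul_inv, le_div_iff₀ (Real.exp_pos _), mul_comm]
  exact hmk

theorem stdNormal_Icc_ge (m : ℝ) :
    ENNReal.ofReal ((√(2 * Real.pi))⁻¹ * Real.exp (-(|m| + 1) ^ 2 / 2))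
      ≤ stdNormal (Set.Icc (m - 1) (m + 1)) := by
  rw [stdNormal, gaussianReal_apply 0 one_ne_zero]
  have hvol : volume (Set.Icc (m - 1) (m + 1)) = 2 := by
    rw [Real.volume_Icc]; norm_num
  calc ENNReal.ofReal ((√(2 * Real.pi))⁻¹ * Real.exp (-(|m| + 1) ^ 2 / 2))
      ≤ ∫⁻ _ in Set.Icc (m - 1) (m + 1),
        ENNReal.ofReal ((√(2 * Real.pi))⁻¹ * Real.exp (-(|m| + 1) ^ 2 / 2)) := by
        rw [setLIntegral_const, hvol]
        exact le_mul_of_one_le_right' (by norm_num)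
    _ ≤ _ := by
        refine setLIntegral_mono' measurableSet_Icc fun x hx => ?_
        refine ENNReal.ofReal_le_ofReal ?_
        rw [gaussianPDFReal_def]
        simp only [NNReal.coe_one, mul_one, sub_zero]
        refine mul_le_mul_of_nonneg_left (Real.exp_le_exp.2 ?_) (by positivity)
        have h1 : |x| ≤ |m| + 1 := by
          rw [abs_le]
          constructor <;> linarith [hx.1, hx.2, neg_abs_le m, le_abs_self m]
        have h2 : x ^ 2 ≤ (|m| + 1) ^ 2 := by
          rw [← sq_abs x]; exact pow_le_pow_left₀ (abs_nonneg _) h1 2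
        linarith

theorem stdGaussianPi_box_ge (x : κ → ℝ) {a : ℝ} (ha : (∑ i, x i ^ 2) / 2 < a) :
    ∀ᶠ ε in 𝓝[>] (0 : ℝ), ENNReal.ofReal (Real.exp (-a / ε))
      ≤ stdGaussianPi κ {z | ∀ i, |√ε * z i - x i| ≤ √ε} := by
  set S := (∑ i, x i ^ 2) / 2 with hS
  have hS0 : 0 ≤ S := by positivity
  obtain ⟨θ, hθ0, hθ⟩ : ∃ θ : ℝ, 0 < θ ∧ (1 + θ) * S < a := by
    refine ⟨(a - S) / (S + 1), by apply div_pos <;> linarith, ?_⟩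
    have : (a - S) / (S + 1) * S < a - S := by
      rw [div_mul_eq_mul_div, div_lt_iff₀ (by linarith)]
      nlinarith
    linarith
  set A := ∏ _i : κ, (√(2 * Real.pi))⁻¹ * Real.exp (-(1 + θ⁻¹) / 2) with hA
  have hA0 : 0 < A := Finset.prod_pos fun _ _ => by positivity
  filter_upwards [eventually_const_mul_exp_le A⁻¹ hθ, self_mem_nhdsWithin] with ε hε hε0
  have hε0 : 0 < ε := hε0
  have hsq : 0 < √ε := Real.sqrt_pos.2 hε0
  have hset : {z : κ → ℝ | ∀ i, |√ε * z i - x i| ≤ √ε}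
      = Set.univ.pi fun i => Set.Icc (x i / √ε - 1) (x i / √ε + 1) := by
    ext z
    simp only [Set.mem_ofPred_eq, Set.mem_pi, Set.mem_univ, true_imp_iff, Set.mem_Icc]
    refine forall_congr' fun i => ?_
    rw [abs_le]
    have h1 : x i = √ε * (x i / √ε) := by field_simp
    constructor
    · rintro ⟨h2, h3⟩
      rw [h1] at h2 h3
      constructor
      · by_contra hc; nlinarith
      · by_contra hc; nlinarith
    · rintro ⟨h2, h3⟩
      rw [h1]
      constructor <;> nlinarith
  have hreal : Real.exp (-a / ε) ≤ ∏ i, ((√(2 * Real.pi))⁻¹ *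
      Real.exp (-(|x i / √ε| + 1) ^ 2 / 2)) := by
    have h1 : Real.exp (-a / ε) ≤ A * Real.exp (-((1 + θ) * S) / ε) := by
      rw [inv_mul_le_iff₀ hA0] at hε
      exact hε
    refine h1.trans ?_
    have h2 : Real.exp (-((1 + θ) * S) / ε)
        = ∏ i, Real.exp (-((1 + θ) * (x i ^ 2 / ε)) / 2) := by
      rw [← Real.exp_sum, hS]
      congr 1
      rw [Finset.sum_div, Finset.mul_sum, ← Finset.sum_neg_distrib, Finset.sum_div]
      refine Finset.sum_congr rfl fun i _ => by ring
    rw [h2, hA, ← Finset.prod_mul_distrib]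
    refine Finset.prod_le_prod (fun i _ => by positivity) fun i _ => ?_
    rw [mul_assoc, ← Real.exp_add]
    refine mul_le_mul_of_nonneg_left (Real.exp_le_exp.2 ?_) (by positivity)
    have h3 : x i ^ 2 / ε = |x i / √ε| ^ 2 := by
      rw [sq_abs, div_pow, Real.sq_sqrt hε0.le]
    rw [h3]
    set m := |x i / √ε|
    have h4 : 2 * m ≤ θ * m ^ 2 + θ⁻¹ := by
      have h5 : θ * m ^ 2 + θ⁻¹ - 2 * m = θ⁻¹ * (θ * m - 1) ^ 2 := by field_simp; ring
      have h6 : 0 ≤ θ⁻¹ * (θ * m - 1) ^ 2 := by positivity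
      linarith
    nlinarith
  rw [hset, Measure.pi_pi]
  refine (ENNReal.ofReal_le_ofReal hreal).trans ?_
  rw [ENNReal.ofReal_prod_of_nonneg fun i _ => by positivity]
  exact Finset.prod_le_prod' fun i _ => stdNormal_Icc_ge _

end FiniteDimensional

section Criterion

variable {B H : Type*} [NormedAddCommGroup B] [NormedSpace ℝ B] [CompleteSpace B]
  [SecondCountableTopology B] [MeasurableSpace B] [BorelSpace B]
  [NormedAddCommGroup H] [InnerProductSpace ℝ H] [CompleteSpace H]
  {j : H →L[ℝ] B} {μ : Measure B} {ι : Type*} {e : ι → StrongDual ℝ B} {b : HilbertBasis ι ℝ H}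
  {S : Type*} [MetricSpace S]

theorem coords_apply_eq_inner (hb : ∀ i, b i = dualToH j (e i)) (s : Finset ι) (h : H) (i : s) :
    coords e s (j h) i = inner ℝ (b i) h := by
  rw [coords_apply, hb, inner_dualToH]

theorem sum_coords_sq_le (hb : ∀ i, b i = dualToH j (e i)) (s : Finset ι) (h : H) :
    ∑ i, coords e s (j h) i ^ 2 ≤ ‖h‖ ^ 2 := by
  simp_rw [coords_apply_eq_inner hb]
  rw [Finset.sum_coe_sort s fun i => inner ℝ (b i) h ^ 2]
  simpa using b.orthonormal.sum_inner_products_le h (s := s)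

theorem exists_coords_eq (hb : ∀ i, b i = dualToH j (e i)) (s : Finset ι) (x : s → ℝ) :
    ∃ h : H, coords e s (j h) = x ∧ ‖h‖ ^ 2 = ∑ i, x i ^ 2 := by
  classical
  have hon : Orthonormal ℝ fun i : s => b i := b.orthonormal.comp _ Subtype.val_injective
  refine ⟨∑ i : s, x i • b i, ?_, ?_⟩
  · ext i
    rw [coords_apply_eq_inner hb]
    exact hon.inner_right_fintype x i
  · rw [← real_inner_self_eq_norm_sq, hon.inner_sum]
    simp [sq]

variable (j e) in
/-- `X` is approximated, uniformly on the exponential scale, by continuous functions of finitely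
many rescaled coordinates, and these approximate `F` on bounded sets. -/
def HasExpApprox (μ : Measure B) (X : ℝ → B → S) (F : H → S) : Prop :=
  ∀ η > 0, ∀ R : ℝ, ∃ (s : Finset ι) (P : ℝ × (s → ℝ) → S), Continuous P ∧
    (∀ h : H, ‖h‖ ≤ R → dist (P (0, coords e s (j h))) (F h) < η) ∧
    ∀ᶠ ε in 𝓝[>] (0 : ℝ), μ {ξ | η ≤ dist (X ε ξ) (P (√ε, √ε • coords e s ξ))}
      ≤ ENNReal.ofReal (Real.exp (-R / ε))

variable {X : ℝ → B → S} {F : H → S}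

theorem HasExpApprox.isCompact_image (happ : HasExpApprox j e μ X F)
    (hb : ∀ i, b i = dualToH j (e i)) (R : ℝ) : IsCompact (F '' Metric.closedBall 0 R) := by
  set T : WeakDual ℝ H → S := fun φ =>
    F ((InnerProductSpace.toDual ℝ H).symm (WeakDual.toStrongDual φ)) with hT
  have hcont : ContinuousOn T (WeakDual.toStrongDual ⁻¹' Metric.closedBall 0 R) := by
    refine continuousOn_of_uniform_approx_of_continuousOn fun u hu => ?_
    obtain ⟨η, hη, hηu⟩ := Metric.mem_uniformity_dist.1 hu
    obtain ⟨s, P, hP, hPF, -⟩ := happ η hη R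
    refine ⟨fun φ => P (0, fun i : s => φ (b i)), Continuous.continuousOn ?_, fun φ hφ => ?_⟩
    · refine hP.comp (continuous_const.prodMk (continuous_pi fun i => ?_))
      exact WeakDual.eval_continuous (b i)
    · apply hηu
      rw [dist_comm]
      have hnorm : ‖(InnerProductSpace.toDual ℝ H).symm (WeakDual.toStrongDual φ)‖ ≤ R := by
        rw [LinearIsometryEquiv.norm_map]
        simpa using hφ
      have := hPF _ hnorm
      convert! this using 4
      ext i
      rw [coords_apply_eq_inner hb, real_inner_comm, InnerProductSpace.toDual_symm_apply]
      rfl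
  have himg : F '' Metric.closedBall 0 R
      = T '' (WeakDual.toStrongDual ⁻¹' Metric.closedBall 0 R) := by
    ext y
    constructor
    · rintro ⟨h, hh, rfl⟩
      refine ⟨WeakDual.toStrongDual.symm (InnerProductSpace.toDual ℝ H h), ?_, ?_⟩
      · simpa using hh
      · simp [hT]
    · rintro ⟨φ, hφ, rfl⟩
      refine ⟨_, ?_, rfl⟩
      simpa using hφ
  rw [himg]
  exact (WeakDual.isCompact_closedBall 0 R).image_of_continuousOn hcont

/-- The rate function `inf {|h|² / 2 : F h = y}`. -/
def contractedRate (F : H → S) (y : S) : ℝ≥0∞ :=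
  ⨅ (h : H) (_ : F h = y), ENNReal.ofReal (‖h‖ ^ 2 / 2)

theorem contractedRate_le (F : H → S) (h : H) :
    contractedRate F (F h) ≤ ENNReal.ofReal (‖h‖ ^ 2 / 2) :=
  iInf₂_le_of_le h rfl le_rfl

theorem contractedRate_sublevel (F : H → S) (c : ℝ≥0) :
    {y | contractedRate F y ≤ c}
      = ⋂ n : ℕ, F '' Metric.closedBall 0 (√(2 * (c + 1 / ((n : ℝ) + 1)))) := by
  ext y
  simp only [Set.mem_ofPred_eq, Set.mem_iInter]
  constructor
  · intro hy n
    have hlt : contractedRate F y < ENNReal.ofReal (c + 1 / ((n : ℝ) + 1)) := by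
      refine lt_of_le_of_lt hy ?_
      rw [← ENNReal.ofReal_coe_nnreal, ENNReal.ofReal_lt_ofReal_iff (by positivity)]
      have : (0 : ℝ) < 1 / ((n : ℝ) + 1) := by positivity
      linarith
    simp only [contractedRate, iInf_lt_iff] at hlt
    obtain ⟨h, hh, hlt⟩ := hlt
    rw [ENNReal.ofReal_lt_ofReal_iff (by positivity)] at hlt
    refine ⟨h, ?_, hh⟩
    rw [mem_closedBall_zero_iff]
    exact Real.le_sqrt_of_sq_le (by linarith)
  · intro hy
    have hlim : Tendsto (fun n : ℕ => ENNReal.ofReal (c + 1 / ((n : ℝ) + 1))) atTop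
        (𝓝 (ENNReal.ofReal (c + 0))) :=
      ENNReal.tendsto_ofReal (tendsto_one_div_add_atTop_nhds_zero_nat.const_add _)
    rw [add_zero, ENNReal.ofReal_coe_nnreal] at hlim
    refine ge_of_tendsto' hlim fun n => ?_
    obtain ⟨h, hh, rfl⟩ := hy n
    refine (contractedRate_le F h).trans (ENNReal.ofReal_le_ofReal ?_)
    rw [mem_closedBall_zero_iff] at hh
    have := (Real.le_sqrt (norm_nonneg _) (by positivity)).1 hh
    linarith

theorem HasExpApprox.isCompact_sublevel (happ : HasExpApprox j e μ X F)
    (hb : ∀ i, b i = dualToH j (e i)) (c : ℝ≥0) :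
    IsCompact {y | contractedRate F y ≤ c} := by
  rw [contractedRate_sublevel]
  exact (happ.isCompact_image hb _).of_isClosed_subset
    (isClosed_iInter fun n => (happ.isCompact_image hb _).isClosed) (Set.iInter_subset _ 0)

theorem HasExpApprox.upper_bound (happ : HasExpApprox j e μ X F) (hμ : IsAbstractWienerSpace j μ)
    (hb : ∀ i, b i = dualToH j (e i)) {C : Set S} (hC : IsClosed C) {a' : ℝ}
    (ha' : (a' : EReal) < ((⨅ y ∈ C, contractedRate F y : ℝ≥0∞) : EReal)) :
    ∀ᶠ ε in 𝓝[>] (0 : ℝ), μ {ξ | X ε ξ ∈ C} ≤ ENNReal.ofReal (Real.exp (-a' / ε)) := by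
  have := hμ.isGaussian
  rcases lt_or_ge a' 0 with hneg | hnn
  · filter_upwards [self_mem_nhdsWithin] with ε hε
    refine prob_le_one.trans ?_
    rw [ENNReal.one_le_ofReal, Real.one_le_exp_iff]
    exact div_nonneg (by linarith) (le_of_lt hε)
  obtain ⟨a, ha'a, ha⟩ := EReal.exists_between_coe_real ha'
  have ha'a : a' < a := by exact_mod_cast ha'a
  have ha0 : 0 < a := by linarith
  have hdisj : ∀ h : H, ‖h‖ ≤ √(2 * a) → F h ∉ C := by
    intro h hh hC'
    have h1 : (⨅ y ∈ C, contractedRate F y) ≤ ENNReal.ofReal a := by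
      refine (iInf₂_le _ hC').trans ((contractedRate_le F h).trans (ENNReal.ofReal_le_ofReal ?_))
      have := (Real.le_sqrt (norm_nonneg _) (by positivity)).1 hh
      linarith
    have h2 : ((⨅ y ∈ C, contractedRate F y : ℝ≥0∞) : EReal) ≤ a := by
      refine (EReal.coe_ennreal_le_coe_ennreal_iff.2 h1).trans ?_
      rw [EReal.coe_ennreal_ofReal, max_eq_left ha0.le]
    exact absurd ha (not_lt.2 h2)
  have hcomp := happ.isCompact_image hb (√(2 * a))
  obtain ⟨η', hη', hsub⟩ := hcomp.exists_thickening_subset_open hC.isOpen_compl (by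
    rintro _ ⟨h, hh, rfl⟩
    exact hdisj h (by simpa using hh))
  set η := η' / 3 with hη
  have hη0 : 0 < η := by positivity
  obtain ⟨s, P, hP, hPF, htail⟩ := happ η hη0 (max (√(2 * a)) a)
  set D : Set (s → ℝ) := {z | ∑ i, z i ^ 2 ≤ 2 * a} with hD
  have hDc : IsCompact D := by
    refine Metric.isCompact_of_isClosed_isBounded (isClosed_le (by fun_prop) continuous_const) ?_
    refine (Metric.isBounded_closedBall (x := (0 : s → ℝ)) (r := √(2 * a))).subset fun z hz => ?_
    rw [mem_closedBall_zero_iff, pi_norm_le_iff_of_nonneg (Real.sqrt_nonneg _)]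
    intro i
    refine Real.abs_le_sqrt (le_trans ?_ hz)
    exact Finset.single_le_sum (f := fun i => z i ^ 2) (fun i _ => sq_nonneg _) (Finset.mem_univ i)
  have hunif : ∀ᶠ t in 𝓝 (0 : ℝ), ∀ z ∈ D, dist (P (t, z)) (P (0, z)) < η := by
    have hopen : IsOpen {p : ℝ × (s → ℝ) | dist (P p) (P (0, p.2)) < η} :=
      isOpen_lt (by fun_prop) continuous_const
    have := hDc.eventually_forall_of_forall_eventually (x₀ := (0 : ℝ))
      (P := fun t z => dist (P (t, z)) (P (0, z)) < η) (fun z _ => by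
        refine hopen.mem_nhds ?_
        simpa using hη0)
    exact this
  have hsqrt : Tendsto (fun ε : ℝ => √ε) (𝓝[>] 0) (𝓝 0) := by
    have := (Real.continuous_sqrt.tendsto 0).mono_left (nhdsWithin_le_nhds (s := Set.Ioi 0))
    simpa using this
  obtain ⟨a₁, h1, h2⟩ := exists_between ha'a
  filter_upwards [htail, hsqrt.eventually hunif, stdGaussianPi_tail (κ := s) h2 (by linarith),
    eventually_const_mul_exp_le 2 h1, self_mem_nhdsWithin] with ε ht hu hg hexp hε
  have hε : 0 < ε := hε
  have hsubset : {ξ | X ε ξ ∈ C} ⊆ {ξ | η ≤ dist (X ε ξ) (P (√ε, √ε • coords e s ξ))}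
      ∪ coords e s ⁻¹' {z | 2 * a < ∑ i, (√ε * z i) ^ 2} := by
    intro ξ hξ
    by_contra hcon
    rw [Set.mem_union, not_or] at hcon
    have hc1 : dist (X ε ξ) (P (√ε, √ε • coords e s ξ)) < η := not_le.1 hcon.1
    have hc2 : ∑ i, (√ε * coords e s ξ i) ^ 2 ≤ 2 * a := not_lt.1 hcon.2
    have hc3 := hu (√ε • coords e s ξ) hc2
    obtain ⟨h, hh, hnorm⟩ := exists_coords_eq hb s (√ε • coords e s ξ)
    have hle : ‖h‖ ≤ √(2 * a) := Real.le_sqrt_of_sq_le (hnorm ▸ hc2)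
    have hc4 := hPF h (hle.trans (le_max_left _ _))
    rw [hh] at hc4
    refine hsub (Metric.mem_thickening_iff.2 ⟨F h, ⟨h, by simpa using hle, rfl⟩, ?_⟩) hξ
    have := dist_triangle4 (X ε ξ) (P (√ε, √ε • coords e s ξ)) (P (0, √ε • coords e s ξ)) (F h)
    linarith
  have hm : Measurable (coords e s) := (coords e s).continuous.measurable
  have hexp2 : Real.exp (-(max (√(2 * a)) a) / ε) ≤ Real.exp (-a₁ / ε) := by
    gcongr
    exact h2.le.trans (le_max_right _ _)
  calc μ {ξ | X ε ξ ∈ C} ≤ ENNReal.ofReal (Real.exp (-a₁ / ε)) +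
        ENNReal.ofReal (Real.exp (-a₁ / ε)) := by
        refine (measure_mono hsubset).trans ((measure_union_le _ _).trans (add_le_add ?_ ?_))
        · exact ht.trans (ENNReal.ofReal_le_ofReal hexp2)
        · rw [← Measure.map_apply hm, map_coords hμ hb]
          · exact hg
          · exact (isOpen_lt continuous_const (by fun_prop)).measurableSet
    _ = ENNReal.ofReal (2 * Real.exp (-a₁ / ε)) := by
        rw [← ENNReal.ofReal_add (Real.exp_nonneg _) (Real.exp_nonneg _), two_mul]
    _ ≤ _ := ENNReal.ofReal_le_ofReal hexp

theorem HasExpApprox.lower_bound (happ : HasExpApprox j e μ X F) (hμ : IsAbstractWienerSpace j μ)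
    (hb : ∀ i, b i = dualToH j (e i)) {O : Set S} (hO : IsOpen O) {a : ℝ}
    (ha : ((⨅ y ∈ O, contractedRate F y : ℝ≥0∞) : EReal) < (a : EReal)) :
    ∀ᶠ ε in 𝓝[>] (0 : ℝ), ENNReal.ofReal (Real.exp (-a / ε)) ≤ μ {ξ | X ε ξ ∈ O} := by
  have := hμ.isGaussian
  obtain ⟨h, hhO, hha⟩ : ∃ h : H, F h ∈ O ∧ ‖h‖ ^ 2 / 2 < a := by
    have ha0 : 0 < a := by
      have := (EReal.coe_ennreal_nonneg _).trans_lt ha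
      exact_mod_cast this
    have h1 : (⨅ y ∈ O, contractedRate F y) < ENNReal.ofReal a := by
      rw [← EReal.coe_ennreal_lt_coe_ennreal_iff, EReal.coe_ennreal_ofReal, max_eq_left ha0.le]
      exact ha
    simp only [contractedRate, iInf_lt_iff] at h1
    obtain ⟨y, hy, h, rfl, hlt⟩ := h1
    rw [ENNReal.ofReal_lt_ofReal_iff ha0] at hlt
    exact ⟨h, hy, hlt⟩
  obtain ⟨η', hη', hball⟩ := Metric.isOpen_iff.1 hO _ hhO
  set η := η' / 3 with hη
  have hη0 : 0 < η := by positivity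
  obtain ⟨s, P, hP, hPF, htail⟩ := happ η hη0 (max ‖h‖ a)
  set x := coords e s (j h) with hx
  have hPx := hPF h (le_max_left _ _)
  obtain ⟨r, hr, hPr⟩ := Metric.continuousAt_iff.1 (hP.continuousAt (x := (0, x))) η hη0
  obtain ⟨a₁, h1, h2⟩ := exists_between hha
  have hsqrt : Tendsto (fun ε : ℝ => √ε) (𝓝[>] 0) (𝓝 0) := by
    have := (Real.continuous_sqrt.tendsto 0).mono_left (nhdsWithin_le_nhds (s := Set.Ioi 0))
    simpa using this
  have hxa : (∑ i, x i ^ 2) / 2 < a₁ := by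
    have := sum_coords_sq_le hb s h
    rw [← hx] at this
    linarith
  filter_upwards [htail, hsqrt.eventually (gt_mem_nhds hr), stdGaussianPi_box_ge x hxa,
    eventually_const_mul_exp_le 2 h2, self_mem_nhdsWithin] with ε ht hεr hg hexp hε
  have hε : 0 < ε := hε
  have hm : Measurable (coords e s) := (coords e s).continuous.measurable
  have hsubset : coords e s ⁻¹' {z | ∀ i, |√ε * z i - x i| ≤ √ε} ⊆ {ξ | X ε ξ ∈ O} ∪
      {ξ | η ≤ dist (X ε ξ) (P (√ε, √ε • coords e s ξ))} := by
    intro ξ hξ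
    by_contra hcon
    rw [Set.mem_union, not_or] at hcon
    have hc1 : dist (X ε ξ) (P (√ε, √ε • coords e s ξ)) < η := not_le.1 hcon.2
    have hξ : ∀ i, |√ε * coords e s ξ i - x i| ≤ √ε := hξ
    have hd : dist ((√ε, √ε • coords e s ξ) : ℝ × (s → ℝ)) (0, x) < r := by
      rw [Prod.dist_eq, max_lt_iff]
      constructor
      · simpa [abs_of_nonneg (Real.sqrt_nonneg ε)] using hεr
      · refine lt_of_le_of_lt ?_ hεr
        rw [dist_pi_le_iff (Real.sqrt_nonneg _)]
        exact hξ
    have hc2 := hPr hd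
    refine hcon.1 (hball ?_)
    rw [Metric.mem_ball]
    have := dist_triangle4 (X ε ξ) (P (√ε, √ε • coords e s ξ)) (P (0, x)) (F h)
    linarith
  have hexp2 : Real.exp (-(max ‖h‖ a) / ε) ≤ Real.exp (-a / ε) := by
    gcongr
    exact le_max_right _ _
  have hsum : ENNReal.ofReal (Real.exp (-a / ε)) + ENNReal.ofReal (Real.exp (-a / ε))
      ≤ μ {ξ | X ε ξ ∈ O} + ENNReal.ofReal (Real.exp (-a / ε)) := by
    calc _ = ENNReal.ofReal (2 * Real.exp (-a / ε)) := by
          rw [← ENNReal.ofReal_add (Real.exp_nonneg _) (Real.exp_nonneg _), two_mul]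
      _ ≤ ENNReal.ofReal (Real.exp (-a₁ / ε)) := ENNReal.ofReal_le_ofReal hexp
      _ ≤ _ := hg
      _ = μ (coords e s ⁻¹' {z | ∀ i, |√ε * z i - x i| ≤ √ε}) := by
          rw [← map_coords hμ hb, Measure.map_apply hm]
          have : IsClosed {z : s → ℝ | ∀ i, |√ε * z i - x i| ≤ √ε} := by
            simp only [Set.ofPred_forall]
            exact isClosed_iInter fun i => isClosed_le (by fun_prop) continuous_const
          exact this.measurableSet
      _ ≤ _ := (measure_mono hsubset).trans (measure_union_le _ _)
      _ ≤ _ := add_le_add le_rfl (ht.trans (ENNReal.ofReal_le_ofReal hexp2))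
  exact (ENNReal.add_le_add_iff_right ENNReal.ofReal_ne_top).1 hsum

theorem HasExpApprox.satisfiesLDP [MeasurableSpace S] [BorelSpace S]
    (happ : HasExpApprox j e μ X F) (hμ : IsAbstractWienerSpace j μ)
    (hb : ∀ i, b i = dualToH j (e i)) (hX : ∀ ε > 0, AEMeasurable (X ε) μ) :
    SatisfiesLDP (fun ε => μ.map (X ε)) (contractedRate F) where
  isProbabilityMeasure ε hε := by
    have := hμ.isGaussian
    exact Measure.isProbabilityMeasure_map (hX ε hε)
  lowerSemicontinuous := by
    rw [lowerSemicontinuous_iff_isClosed_preimage]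
    intro c
    induction c with
    | top => simp
    | coe c => exact (happ.isCompact_sublevel hb c).isClosed
  isCompact_sublevel := happ.isCompact_sublevel hb
  exists_ne_top := ⟨F 0, ne_top_of_le_ne_top ENNReal.ofReal_ne_top (contractedRate_le F 0)⟩
  upper_bound C hC := by
    refine limsup_mul_log_le fun a ha => ?_
    filter_upwards [happ.upper_bound hμ hb hC ha, self_mem_nhdsWithin] with ε h hε
    rw [Measure.map_apply_of_aemeasurable (hX ε hε) hC.measurableSet]
    exact h
  lower_bound O hO := by
    refine le_liminf_mul_log fun a ha => ?_
    filter_upwards [happ.lower_bound hμ hb hO ha, self_mem_nhdsWithin] with ε h hε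
    rw [Measure.map_apply_of_aemeasurable (hX ε hε) hO.measurableSet]
    exact h

end Criterion

section ScaledComb

variable {κ A F : Type*} [Fintype κ] [NormedAddCommGroup F] [NormedSpace ℝ F]
  {J : Finset A} {α : A → κ → ℕ} {y : A → F}

/-- The homogenised form of a combination of Hermite polynomials. -/
def scaledComb (J : Finset A) (α : A → κ → ℕ) (y : A → F) (p : ℝ × (κ → ℝ)) : F :=
  ∑ a ∈ J, (∏ i, scaledHermite (α a i) p.1 (p.2 i) / √((α a i).factorial : ℝ)) • y a

@[fun_prop]
theorem continuous_scaledComb : Continuous (scaledComb J α y) := by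
  unfold scaledComb
  refine continuous_finsetSum _ fun a _ => Continuous.smul ?_ continuous_const
  refine continuous_finsetProd _ fun i _ => Continuous.div_const ?_ _
  exact (continuous_scaledHermite (α a i)).comp
    (continuous_fst.prodMk ((continuous_apply i).comp continuous_snd))

theorem scaledComb_zero (z : κ → ℝ) : scaledComb J α y (0, z) = monomialComb J α y z := by
  simp [scaledComb, monomialComb, scaledHermite_zero]

theorem scaledComb_smul {k : ℕ} (hα : ∀ a ∈ J, ∑ i, α a i = k) (t : ℝ) (z : κ → ℝ) :
    scaledComb J α y (t, t • z) = t ^ k • hermiteComb J α y z := by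
  simp only [scaledComb, hermiteComb, Finset.smul_sum, smul_smul]
  refine Finset.sum_congr rfl fun a ha => ?_
  congr 1
  rw [← hα a ha, ← Finset.prod_pow_eq_pow_sum, hermiteProd, ← Finset.prod_mul_distrib]
  refine Finset.prod_congr rfl fun i _ => ?_
  rw [Pi.smul_apply, smul_eq_mul, scaledHermite_mul, hermiteFun_eq, mul_div_assoc]

end ScaledComb

theorem norm_sub_sq_eq_integral {Ω F : Type*} [MeasurableSpace Ω] {μ : Measure Ω}
    [NormedAddCommGroup F] (f g : Lp F 2 μ) :
    ‖f - g‖ ^ 2 = ∫ ξ, ‖f ξ - g ξ‖ ^ 2 ∂μ := by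
  have h1 : ∫ ξ, ‖f ξ - g ξ‖ ^ 2 ∂μ = ∫ ξ, ‖(f - g) ξ‖ ^ 2 ∂μ := by
    refine integral_congr_ae ?_
    filter_upwards [Lp.coeFn_sub f g] with ξ hξ
    rw [hξ, Pi.sub_apply]
  have h2 := lintegral_enorm_sq_Lp (f - g)
  rw [h1, integral_eq_lintegral_of_nonneg_ae (ae_of_all _ fun ξ => by positivity)
    (AEStronglyMeasurable.fun_pow (Lp.aestronglyMeasurable (f - g)).norm 2)]
  simp_rw [ENNReal.ofReal_pow (norm_nonneg _), ofReal_norm]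
  rw [h2, ENNReal.toReal_ofReal (by positivity)]

section Main

variable {B H : Type*} [NormedAddCommGroup B] [NormedSpace ℝ B] [CompleteSpace B]
  [SecondCountableTopology B] [MeasurableSpace B] [BorelSpace B]
  [NormedAddCommGroup H] [InnerProductSpace ℝ H] [CompleteSpace H]
  {j : H →L[ℝ] B} {μ : Measure B} {ι : Type*} {e : ι → StrongDual ℝ B} {b : HilbertBasis ι ℝ H}
  {W : Type*} [Fintype W] {E : W → Type*} [∀ τ, NormedAddCommGroup (E τ)]
  [∀ τ, NormedSpace ℝ (E τ)] [∀ τ, CompleteSpace (E τ)]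

/-- The continuous function of `√ε` and of the rescaled coordinates that a rescaled family of
Hermite combinations is equal to. -/
def polyMap (K : W → ℕ) (c : ∀ τ, ℕ → (ι →₀ ℕ) →₀ E τ) (s : Finset ι) (p : ℝ × (s → ℝ)) :
    ∀ τ, E τ :=
  fun τ => ∑ k ∈ Finset.range (K τ + 1),
    p.1 ^ (K τ - k) • scaledComb (c τ k).support (fun α (i : s) => α i) (c τ k) p

theorem continuous_polyMap (K : W → ℕ) (c : ∀ τ, ℕ → (ι →₀ ℕ) →₀ E τ) (s : Finset ι) :
    Continuous (polyMap K c s) := by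
  refine continuous_pi fun τ => ?_
  simp only [polyMap]
  fun_prop

theorem polyMap_zero (K : W → ℕ) (c : ∀ τ, ℕ → (ι →₀ ℕ) →₀ E τ) (s : Finset ι) (z : s → ℝ)
    (τ : W) : polyMap K c s (0, z) τ
      = monomialComb (c τ (K τ)).support (fun α (i : s) => α i) (c τ (K τ)) z := by
  simp only [polyMap]
  rw [Finset.sum_eq_single (K τ)]
  · simp [scaledComb_zero]
  · intro k hk hne
    have : K τ - k ≠ 0 := by
      have := Finset.mem_range.1 hk
      lia
    simp [this]
  · simp

theorem polyMap_sqrt {K : W → ℕ} {c : ∀ τ, ℕ → (ι →₀ ℕ) →₀ E τ} {s : Finset ι} {τ : W}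
    (hc : ∀ k ≤ K τ, ∀ α ∈ (c τ k).support, α.degree = k)
    (hs : ∀ k ≤ K τ, ∀ α ∈ (c τ k).support, α.support ⊆ s) {ε : ℝ} (hε : 0 < ε) (ξ : B) :
    polyMap K c s (√ε, √ε • coords e s ξ) τ
      = ε ^ ((K τ : ℝ) / 2) • ∑ k ∈ Finset.range (K τ + 1), chaosComb e (c τ k) ξ := by
  rw [Real.rpow_div_two_eq_sqrt _ hε.le, Real.rpow_natCast, Finset.smul_sum]
  simp only [polyMap]
  refine Finset.sum_congr rfl fun k hk => ?_
  have hk : k ≤ K τ := Nat.lt_succ_iff.1 (Finset.mem_range.1 hk)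
  rw [scaledComb_smul (k := k) fun α hα => by rw [sum_coe_eq_degree (hs k hk α hα), hc k hk α hα],
    smul_smul, ← pow_add, Nat.sub_add_cancel hk, chaosComb_eq_hermiteComb e (hs k hk)]

theorem aemeasurable_rescaled [∀ τ, SecondCountableTopology (E τ)] [∀ τ, MeasurableSpace (E τ)]
    [∀ τ, BorelSpace (E τ)] (K : W → ℕ) (Ψ : ∀ τ, ℕ → Lp (E τ) 2 μ) (ε : ℝ) :
    AEMeasurable (rescaled K Ψ ε) μ := by
  refine aemeasurable_pi_lambda _ fun τ => ?_
  simp only [rescaled]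
  have : AEStronglyMeasurable (fun ξ => ε ^ ((K τ : ℝ) / 2) •
      ∑ k ∈ Finset.range (K τ + 1), Ψ τ k ξ) μ :=
    AEStronglyMeasurable.const_smul (Finset.aestronglyMeasurable_fun_sum _ fun k _ =>
      Lp.aestronglyMeasurable (Ψ τ k)) _
  exact this.aemeasurable

/-- Superexponential closeness of the rescaled families in terms of their `L²` distance. -/
theorem measure_rescaled_sub_le (hμ : IsAbstractWienerSpace j μ)
    (hb : ∀ i, b i = dualToH j (e i)) {K : W → ℕ} {Φ Ψ : ∀ τ, ℕ → Lp (E τ) 2 μ} {N M ε : ℝ}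
    (hΦ : ∀ τ, ∀ k ≤ K τ, Φ τ k - Ψ τ k ∈ chaos μ e (E τ) k)
    (hN : ∀ τ, ∀ k ≤ K τ, ‖Φ τ k - Ψ τ k‖ < N) (hM : 1 < M) (hε : 0 < ε) (hε1 : ε ≤ 1) {η : ℝ}
    (hη : 0 < η) (hη' : ∀ τ, (K τ + 1) * (6 * M ^ K τ * N) < η) :
    μ {ξ | η ≤ dist (rescaled K Φ ε ξ) (rescaled K Ψ ε ξ)}
      ≤ ENNReal.ofReal ((∑ τ, ((K τ : ℝ) + 1)) * (2 * Real.exp (1 / 4)) *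
        Real.exp (-(M ^ 2 / 4) / ε)) := by
  have hsq : 0 < √ε := Real.sqrt_pos.2 hε
  have hsq1 : √ε ≤ 1 := Real.sqrt_le_one.2 hε1
  set r := M / √ε with hr
  have hMr : M ≤ r := by
    rw [hr, le_div_iff₀ hsq]
    exact mul_le_of_le_one_right (by linarith) hsq1
  have hr1 : 1 < r := hM.trans_le hMr
  have htail : ∀ τ, ∀ k ≤ K τ, μ {ξ | 6 * r ^ k * N < ‖(Φ τ k - Ψ τ k) ξ‖}
      ≤ ENNReal.ofReal (2 * Real.exp (1 / 4) * Real.exp (-(M ^ 2 / 4) / ε)) := by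
    intro τ k hk
    refine (chaos_tail hμ hb (hΦ τ k hk) hr1 (hN τ k hk)).trans (le_of_eq ?_)
    rw [mul_assoc, ENNReal.ofReal_mul (by norm_num), ← Real.exp_add, ENNReal.ofReal_ofNat]
    congr 3
    rw [hr, div_pow, Real.sq_sqrt hε.le]
    ring
  set I : Finset (Σ _ : W, ℕ) := Finset.univ.sigma fun τ => Finset.range (K τ + 1) with hI
  have hsub : ∀ᵐ ξ ∂μ, η ≤ dist (rescaled K Φ ε ξ) (rescaled K Ψ ε ξ) →
      ξ ∈ ⋃ p ∈ I, {ξ | 6 * r ^ p.2 * N < ‖(Φ p.1 p.2 - Ψ p.1 p.2) ξ‖} := by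
    have hae : ∀ᵐ ξ ∂μ, ∀ p ∈ I, (Φ p.1 p.2 - Ψ p.1 p.2) ξ = Φ p.1 p.2 ξ - Ψ p.1 p.2 ξ := by
      rw [Filter.eventually_all_finset]
      intro p _
      exact Lp.coeFn_sub _ _
    filter_upwards [hae] with ξ hξ hdist
    by_contra hcon
    simp only [Set.mem_iUnion, not_exists] at hcon
    refine absurd hdist (not_le.2 ((dist_pi_lt_iff hη).2 fun τ => ?_))
    refine lt_of_le_of_lt ?_ (hη' τ)
    rw [dist_eq_norm]
    simp only [rescaled]
    rw [← smul_sub, ← Finset.sum_sub_distrib, norm_smul, Real.norm_of_nonneg (by positivity),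
      Real.rpow_div_two_eq_sqrt _ hε.le, Real.rpow_natCast]
    have hterm : ∀ k ∈ Finset.range (K τ + 1), ‖Φ τ k ξ - Ψ τ k ξ‖ ≤ 6 * r ^ K τ * N := by
      intro k hk
      have hkI : (⟨τ, k⟩ : Σ _ : W, ℕ) ∈ I := by simpa [hI] using hk
      have h1 := hcon ⟨τ, k⟩ hkI
      have h2 : ‖(Φ τ k - Ψ τ k) ξ‖ ≤ 6 * r ^ k * N := not_lt.1 h1
      rw [hξ ⟨τ, k⟩ hkI] at h2
      have hk' : k ≤ K τ := Nat.lt_succ_iff.1 (Finset.mem_range.1 hk)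
      have hN0 : 0 ≤ N := (norm_nonneg _).trans (hN τ k hk').le
      refine h2.trans ?_
      gcongr
      exact hr1.le
    calc √ε ^ K τ * ‖∑ k ∈ Finset.range (K τ + 1), (Φ τ k ξ - Ψ τ k ξ)‖
        ≤ √ε ^ K τ * ∑ k ∈ Finset.range (K τ + 1), 6 * r ^ K τ * N := by
          gcongr
          exact (norm_sum_le _ _).trans (Finset.sum_le_sum hterm)
      _ = (K τ + 1) * (6 * (√ε * r) ^ K τ * N) := by
          rw [Finset.sum_const, Finset.card_range, nsmul_eq_mul, mul_pow]
          push_cast; ring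
      _ = _ := by rw [hr, mul_div_cancel₀ _ hsq.ne']
  calc μ {ξ | η ≤ dist (rescaled K Φ ε ξ) (rescaled K Ψ ε ξ)}
      ≤ μ (⋃ p ∈ I, {ξ | 6 * r ^ p.2 * N < ‖(Φ p.1 p.2 - Ψ p.1 p.2) ξ‖}) := by
        refine measure_mono_ae ?_
        filter_upwards [hsub] with ξ hξ using hξ
    _ ≤ ∑ p ∈ I, μ {ξ | 6 * r ^ p.2 * N < ‖(Φ p.1 p.2 - Ψ p.1 p.2) ξ‖} :=
        measure_biUnion_finset_le _ _
    _ ≤ ∑ _p ∈ I, ENNReal.ofReal (2 * Real.exp (1 / 4) * Real.exp (-(M ^ 2 / 4) / ε)) := by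
        refine Finset.sum_le_sum fun p hp => htail _ _ ?_
        simp only [hI, Finset.mem_sigma, Finset.mem_univ, true_and, Finset.mem_range] at hp
        lia
    _ = _ := by
        rw [Finset.sum_const, nsmul_eq_mul, ← ENNReal.ofReal_natCast,
          ← ENNReal.ofReal_mul (by positivity), hI, Finset.card_sigma]
        congr 1
        simp only [Finset.card_range]
        push_cast
        ring

theorem hasExpApprox_rescaled (hμ : IsAbstractWienerSpace j μ)
    (hb : ∀ i, b i = dualToH j (e i)) (K : W → ℕ) (Ψ : ℝ → ∀ τ, ℕ → Lp (E τ) 2 μ)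
    (hΨ : ∀ δ ∈ Set.Ico (0 : ℝ) 1, ∀ τ, ∀ k ≤ K τ, Ψ δ τ k ∈ chaos μ e (E τ) k)
    (hconv : ∀ τ, ∀ k ≤ K τ,
      Tendsto (fun δ : ℝ => ∫ ξ, ‖Ψ δ τ k ξ - Ψ 0 τ k ξ‖ ^ 2 ∂μ) (𝓝[>] 0) (𝓝 0))
    (δ : ℝ → ℝ) (hδ_nonneg : ∀ ε, 0 < ε → 0 ≤ δ ε) (hδ : Tendsto δ (𝓝[>] 0) (𝓝 0)) :
    HasExpApprox j e μ (fun ε => rescaled K (Ψ (δ ε)) ε) (homPart j K (Ψ 0)) := by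
  classical
  intro η hη R
  set M := 2 * (|R| + 1) with hM
  have hM1 : 1 < M := by linarith [abs_nonneg R]
  have hMR : R < M ^ 2 / 4 := by
    rw [hM]; nlinarith [abs_nonneg R, le_abs_self R]
  set L := ∑ τ, K τ with hL
  have hKL : ∀ τ, K τ ≤ L := fun τ =>
    Finset.single_le_sum (f := K) (fun _ _ => Nat.zero_le _) (Finset.mem_univ τ)
  set N := η / (7 * (L + 1) * M ^ L * Real.exp (R ^ 2 / 2)) with hN
  have hN0 : 0 < N := by positivity
  have hNeq : (7 * (L + 1) * M ^ L) * Real.exp (R ^ 2 / 2) * N = η := by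
    rw [hN]; field_simp
  have hML : 1 ≤ M ^ L := one_le_pow₀ hM1.le
  have hexp1 : 1 ≤ Real.exp (R ^ 2 / 2) := Real.one_le_exp (by positivity)
  have hNR : Real.exp (R ^ 2 / 2) * N < η := by
    have h1 : 1 < 7 * ((L : ℝ) + 1) * M ^ L := by
      have : (1 : ℝ) ≤ (L : ℝ) + 1 := by linarith [Nat.cast_nonneg (α := ℝ) L]
      nlinarith
    have h2 : 0 < Real.exp (R ^ 2 / 2) * N := by positivity
    nlinarith
  have hNK : ∀ τ, (K τ + 1) * (6 * M ^ K τ * N) < η := by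
    intro τ
    have h1 : (K τ : ℝ) ≤ L := by exact_mod_cast hKL τ
    have h2 : M ^ K τ ≤ M ^ L := pow_le_pow_right₀ hM1.le (hKL τ)
    calc ((K τ : ℝ) + 1) * (6 * M ^ K τ * N) ≤ (L + 1) * (6 * M ^ L * N) := by gcongr
      _ < (L + 1) * (7 * M ^ L * N) := by gcongr; norm_num
      _ = (7 * (L + 1) * M ^ L) * 1 * N := by ring
      _ ≤ (7 * (L + 1) * M ^ L) * Real.exp (R ^ 2 / 2) * N := by gcongr
      _ = η := hNeq
  have hex : ∀ τ k, ∃ (g : Lp (E τ) 2 μ) (c : (ι →₀ ℕ) →₀ E τ), k ≤ K τ →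
      g ∈ chaos μ e (E τ) k ∧ ‖Ψ 0 τ k - g‖ < N / 2 ∧
      (∀ α ∈ c.support, α.degree = k) ∧ g =ᵐ[μ] chaosComb e c := by
    intro τ k
    by_cases hk : k ≤ K τ
    · obtain ⟨g, c, h⟩ := exists_chaosComb_norm_sub_lt (hΨ 0 (by simp) τ k hk) (half_pos hN0)
      exact ⟨g, c, fun _ => h⟩
    · exact ⟨0, 0, fun h => absurd h hk⟩
  choose g c hgc using hex
  set s : Finset ι := Finset.univ.biUnion fun τ => (Finset.range (K τ + 1)).biUnion fun k =>
    (c τ k).support.biUnion Finsupp.support with hs_def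
  have hs : ∀ τ, ∀ k ≤ K τ, ∀ α ∈ (c τ k).support, α.support ⊆ s := by
    intro τ k hk α hα i hi
    simp only [hs_def, Finset.mem_biUnion]
    exact ⟨τ, Finset.mem_univ _, k, Finset.mem_range.2 (Nat.lt_succ_of_le hk), α, hα, hi⟩
  refine ⟨s, polyMap K c s, continuous_polyMap K c s, fun h hh => ?_, ?_⟩
  · rw [dist_pi_lt_iff hη]
    intro τ
    obtain ⟨-, hg1, -, hg3⟩ := hgc τ (K τ) le_rfl
    rw [polyMap_zero, ← integral_chaosComb_add hμ hb h hg3 (hs τ (K τ) le_rfl), dist_comm,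
      dist_eq_norm]
    refine lt_of_le_of_lt (norm_integral_add_sub_le hμ hb h _ _) (lt_of_le_of_lt ?_ hNR)
    have hhR : ‖h‖ ^ 2 ≤ R ^ 2 := pow_le_pow_left₀ (norm_nonneg _) hh 2
    gcongr
    linarith
  · have hclose : ∀ᶠ ε in 𝓝[>] (0 : ℝ), ∀ τ, ∀ k ∈ Finset.range (K τ + 1),
        ‖Ψ (δ ε) τ k - Ψ 0 τ k‖ < N / 2 := by
      rw [eventually_all]
      intro τ
      rw [Filter.eventually_all_finset]
      intro k hk
      have hk : k ≤ K τ := Nat.lt_succ_iff.1 (Finset.mem_range.1 hk)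
      set φ : ℝ → ℝ := fun d => ∫ ξ, ‖Ψ d τ k ξ - Ψ 0 τ k ξ‖ ^ 2 ∂μ with hφ
      have hφ0 : φ 0 = 0 := by simp [hφ]
      have hφc : ContinuousWithinAt φ (Set.Ici 0) 0 := by
        rw [← continuousWithinAt_Ioi_iff_Ici, ContinuousWithinAt, hφ0]
        exact hconv τ k hk
      have hδ' : Tendsto δ (𝓝[>] 0) (𝓝[≥] 0) :=
        tendsto_nhdsWithin_iff.2 ⟨hδ, by
          filter_upwards [self_mem_nhdsWithin] with ε hε using hδ_nonneg ε hε⟩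
      have hlim : Tendsto (fun ε => φ (δ ε)) (𝓝[>] 0) (𝓝 0) := by
        have := hφc.tendsto.comp hδ'
        rwa [hφ0] at this
      filter_upwards [hlim.eventually (gt_mem_nhds (show 0 < (N / 2) ^ 2 by positivity))] with ε hε
      simp only [hφ] at hε
      rw [← norm_sub_sq_eq_integral] at hε
      exact lt_of_pow_lt_pow_left₀ 2 (by positivity) hε
    have hδ1 : ∀ᶠ ε in 𝓝[>] (0 : ℝ), δ ε < 1 := hδ.eventually (gt_mem_nhds one_pos)
    have hε1 : ∀ᶠ ε in 𝓝[>] (0 : ℝ), ε ≤ 1 :=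
      nhdsWithin_le_nhds (Iic_mem_nhds one_pos)
    filter_upwards [hclose, hδ1, hε1, self_mem_nhdsWithin,
      eventually_const_mul_exp_le ((∑ τ, ((K τ : ℝ) + 1)) * (2 * Real.exp (1 / 4))) hMR]
      with ε hcl hδε hε1 hε hexp
    have hε : 0 < ε := hε
    have key := measure_rescaled_sub_le hμ hb (K := K) (Φ := Ψ (δ ε)) (Ψ := g) (N := N) (M := M)
      (fun τ k hk => Submodule.sub_mem _ (hΨ (δ ε) ⟨hδ_nonneg ε hε, hδε⟩ τ k hk) (hgc τ k hk).1)
      (fun τ k hk => by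
        have h1 := hcl τ k (Finset.mem_range.2 (Nat.lt_succ_of_le hk))
        have h2 := (hgc τ k hk).2.1
        have h3 := norm_add_le (Ψ (δ ε) τ k - Ψ 0 τ k) (Ψ 0 τ k - g τ k)
        rw [sub_add_sub_cancel] at h3
        linarith) hM1 hε hε1 hη hNK
    refine le_trans (le_trans (le_of_eq (measure_congr ?_)) key) (ENNReal.ofReal_le_ofReal hexp)
    have hae : ∀ᵐ ξ ∂μ, ∀ τ, ∀ k ∈ Finset.range (K τ + 1), g τ k ξ = chaosComb e (c τ k) ξ := by
      rw [eventually_all]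
      intro τ
      rw [Filter.eventually_all_finset]
      intro k hk
      exact (hgc τ k (Nat.lt_succ_iff.1 (Finset.mem_range.1 hk))).2.2.2
    filter_upwards [hae] with ξ hξ
    have hpoly : polyMap K c s (√ε, √ε • coords e s ξ) = rescaled K g ε ξ := by
      ext τ
      rw [polyMap_sqrt (fun k hk => (hgc τ k hk).2.2.1) (hs τ) hε]
      simp only [rescaled]
      rw [Finset.sum_congr rfl fun k hk => (hξ τ k hk).symm]
    have : (η ≤ dist (rescaled K (Ψ (δ ε)) ε ξ) (polyMap K c s (√ε, √ε • coords e s ξ)))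
        = (η ≤ dist (rescaled K (Ψ (δ ε)) ε ξ) (rescaled K g ε ξ)) := by rw [hpoly]
    exact this

end Main

end WienerChaos

end

/-- `Ψ δ τ k` is the `k`-th chaos component of `Ψ_{δ; τ}`; the limit is `Ψ 0`. -/
theorem theorem3p3
    {B H : Type*} [NormedAddCommGroup B] [NormedSpace ℝ B] [CompleteSpace B]
    [SecondCountableTopology B] [MeasurableSpace B] [BorelSpace B]
    [NormedAddCommGroup H] [InnerProductSpace ℝ H] [CompleteSpace H]
    (j : H →L[ℝ] B) (μ : Measure B) (hμ : WienerChaos.IsAbstractWienerSpace j μ)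
    {ι : Type*} (e : ι → StrongDual ℝ B) (b : HilbertBasis ι ℝ H)
    (hb : ∀ i, b i = WienerChaos.dualToH j (e i))
    {W : Type*} [Fintype W] (E : W → Type*) [∀ τ, NormedAddCommGroup (E τ)]
    [∀ τ, NormedSpace ℝ (E τ)] [∀ τ, CompleteSpace (E τ)]
    [∀ τ, SecondCountableTopology (E τ)] [∀ τ, MeasurableSpace (E τ)] [∀ τ, BorelSpace (E τ)]
    (K : W → ℕ) (Ψ : ℝ → ∀ τ, ℕ → Lp (E τ) 2 μ)
    (hΨ : ∀ δ ∈ Set.Ico (0 : ℝ) 1, ∀ τ, ∀ k ≤ K τ, Ψ δ τ k ∈ WienerChaos.chaos μ e (E τ) k)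
    (hconv : ∀ τ, ∀ k ≤ K τ,
      Tendsto (fun δ : ℝ => ∫ ξ, ‖Ψ δ τ k ξ - Ψ 0 τ k ξ‖ ^ 2 ∂μ) (𝓝[>] 0) (𝓝 0))
    (δ : ℝ → ℝ) (hδ_nonneg : ∀ ε, 0 < ε → 0 ≤ δ ε) (hδ : Tendsto δ (𝓝[>] 0) (𝓝 0)) :
    SatisfiesLDP (fun ε : ℝ => μ.map (WienerChaos.rescaled K (Ψ (δ ε)) ε))
      (WienerChaos.rateFunction j K (Ψ 0)) := by
  exact (WienerChaos.hasExpApprox_rescaled hμ hb K Ψ hΨ hconv δ hδ_nonneg hδ).satisfiesLDP hμ hb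
    fun ε _ => WienerChaos.aemeasurable_rescaled K (Ψ (δ ε)) ε
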